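/- **Fine's theorem for flower scenarios.** *Simplicial distributions.* For a set $U$ let $D(U)$ be the set of finitely supported functions $p:U\to\mathbb{R}_{\ge 0}$ with $\sum_u p(u)=1$. For a simplicial set $Y$ let $D(Y)$ be the simplicial set with $D(Y)_n=D(Y_n)$ and structure maps given by push-forward. A simplicial distribution on a simplicial set $X$ with outcomes in $Y$ is a simplicial map $p:X\to D(Y)$. Here $Y=N\mathbb{Z}_2$, the nerve of the group $\mathbb{Z}_2$. Each simplicial map $s:X\to Y$ gives the deterministic distribution $\delta^s$, with $(\delta^s)_\sigma=\delta^{s_\sigma}$. We call $p$ *non-contextual* if there is a finitely supported probability distribution $d$ on the set of simplicial maps $s:X\to Y$ such that $p_\sigma=\sum_s d(s)\,\delta^{s_\sigma}$ for every simplex $\sigma$ of $X$. For a $1$-simplex $\tau$ put $\bar\tau=p_\tau(0)-p_\tau(1)$. *Cones.* $\mathrm{Cone}(X)=\Delta^0\ast X$ is the simplicial set obtained by joining every simplex of $X$ to a new vertex $c$: its $n$-simplices are $c_n$, the $n$-simplices of $X$, and the pairs $(c_k,\sigma)$ with $\sigma\in X_l$ and $k+1+l=n$. *Flower scenarios.*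 Let $k\ge 1$ and $N_1,\dots,N_k\ge 1$. Let $L_{N}$ be the $1$-dimensional simplicial set given by a line of $N$ edges, each directed arbitrarily. Let $X=X(N_1,\dots,N_k)$ be obtained by gluing $L_{N_1},\dots,L_{N_k}$ at their two end points: all initial points are identified to one vertex $v$ and all final points to another vertex $w$. The flower scenario is $\mathrm{Cone}(X)$. *Circles.* For $N\ge1$ an $N$-circle $C_N$ is the $1$-dimensional simplicial set given by a closed cycle of $N$ edges $\tau_1,\dots,\tau_N$ (a loop if $N=1$), each directed arbitrarily. An $N$-circle in $X$ is an injective simplicial map $C_N\to X$. A distribution on $C_N$ satisfies the *$N$-circle inequalities* if $$0\le N-2+\sum_{i=1}^N(-1)^{a_i}\,\bar\tau_i\qquad\text{for all } a\in\mathbb{Z}_2^N \text{ with } \sum_{i=1}^N a_i = N+1 \pmod 2 .$$ **Theorem.** Let $X=X(N_1,\dots,N_k)$. A simplicial distribution $p$ on $\mathrm{Cone}(X)$ with outcomes in $N\mathbb{Z}_2$ is non-contextual if and only if, for every $N\ge 1$ and every $N$-circle $C_N\to X$, the restriction $p|_{C_N}$ satisfies the $N$-circle inequalities. -/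

import Mathlib

open CategoryTheory Opposite

noncomputable section

namespace SimplicialContextuality

/-! ### Distributions, simplicial distributions and contextuality -/

/-- `D_R(U)` for `R = ℝ≥0`: finitely supported functions `U → ℝ≥0` with total mass `1`. -/
abbrev Dist (U : Type) : Type := Convexity.StdSimplex NNReal U

/-- The simplicial set `D_R(Y)`: its `n`-simplices are the distributions on `Y_n`, and the
simplicial structure maps are the push-forwards along those of `Y`. -/
def distSpace (Y : SSet.{0}) : SSet.{0} where
  obj n := Dist (Y.obj n)
  map θ := ↾fun p ↦ p.map (Y.map θ)
  map_id n := by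
    ext1; ext1; funext p
    refine Eq.trans ?_ (Convexity.StdSimplex.map_id p)
    change p.map (Y.map (𝟙 n)) = _
    rw [Y.map_id]
    rfl
  map_comp θ η := by
    ext1; ext1; funext p
    refine Eq.trans ?_ (Convexity.StdSimplex.map_comp p (Y.map θ) (Y.map η))
    change p.map (Y.map (θ ≫ η)) = _
    rw [Y.map_comp]
    rfl

/-- A simplicial distribution on the scenario `(X, Y)`. -/
abbrev SDist (X Y : SSet.{0}) : Type := X ⟶ distSpace Y

/-- The canonical map `δ : Y ⟶ D_R(Y)` sending a simplex to its delta distribution. -/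
def delta (Y : SSet.{0}) : Y ⟶ distSpace Y where
  app n := ↾fun y ↦ (Convexity.StdSimplex.single y : Dist (Y.obj n))
  naturality m n θ := by
    ext y
    simp [distSpace]

/-- The deterministic distribution `δ^s = δ ∘ s` of an outcome assignment `s : X ⟶ Y`. -/
def detDist {X Y : SSet.{0}} (s : X ⟶ Y) : SDist X Y := s ≫ delta Y

/-- Deterministic distributions are the same thing as outcome assignments. -/
theorem detDist_injective (X Y : SSet.{0}) :
    Function.Injective (detDist : (X ⟶ Y) → SDist X Y) := by
  intro s t h
  ext n x
  have h1 := congrArg (fun q : SDist X Y ↦ (show Dist (Y.obj n) from q.app n x).weights) h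
  exact Finsupp.single_left_injective one_ne_zero h1

/-- The map `Θ` from distributions on the set of deterministic distributions (indexed by outcome
assignments `s`) to simplicial distributions, `Θ(d)_σ = ∑ s, d(s) δ^{s_σ}`. The right-hand side is
the push-forward of `d` along `s ↦ s_σ`. -/
def theta {X Y : SSet.{0}} (d : Dist (X ⟶ Y)) : SDist X Y where
  app n := ↾fun σ ↦ (d.map (fun s ↦ s.app n σ) : Dist (Y.obj n))
  naturality m n θ := by
    ext σ
    refine Eq.trans ?_ (Convexity.StdSimplex.map_map d _ _).symm
    change d.map (fun s ↦ s.app n (X.map θ σ)) = _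
    simp

/-- A simplicial distribution is non-contextual if it is in the image of `Θ`. -/
def NonContextual {X Y : SSet.{0}} (p : SDist X Y) : Prop :=
  ∃ d : Dist (X ⟶ Y), theta d = p

/-- The outcome space `N ℤ₂`: the nerve of the group `ℤ₂`, regarded as a one-object category. -/
abbrev NZ2 : SSet.{0} := nerve (SingleObj (Multiplicative (ZMod 2)))

/-- The `1`-simplex of `N ℤ₂` given by `a ∈ ℤ₂`. -/
def outcome (a : ZMod 2) : NZ2.obj (op (.mk 1)) :=
  ComposableArrows.mk₁ (C := SingleObj (Multiplicative (ZMod 2)))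
    (X₀ := SingleObj.star _) (X₁ := SingleObj.star _) (Multiplicative.ofAdd a)

/-- The probability `p_τ^a` of the outcome `a` at the edge `τ`. -/
def prob {X : SSet.{0}} (p : SDist X NZ2) (τ : X.obj (op (.mk 1))) (a : ZMod 2) : NNReal :=
  (show Dist (NZ2.obj (op (.mk 1))) from p.app (op (.mk 1)) τ).weights (outcome a)

/-- The expectation value `p_τ^0 - p_τ^1` of the edge `τ`. -/
def expectation {X : SSet.{0}} (p : SDist X NZ2) (τ : X.obj (op (.mk 1))) : ℝ :=
  (prob p τ 0 : ℝ) - (prob p τ 1 : ℝ)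

/-! ### The cone of a simplicial set -/

/-- The `n`-simplices of `Cone(X)`: `apex` is `c_n`; `part 0 n _ σ` is the simplex `σ` of `X`; and
`part (k + 1) l _ σ` is `(c_k, σ)` with `σ ∈ X_l`, `k + 1 + l = n`. In other words, `part b l _ σ`
has its first `b` vertices at the cone point and its last `l + 1` vertices in `X`. -/
inductive ConeSimplex (X : SSet.{0}) (n : ℕ) : Type
  | apex : ConeSimplex X n
  | part (b l : ℕ) (h : b + l = n) (σ : X.obj (op (.mk l))) : ConeSimplex X n

/-- The number of vertices of `[m]` which the monotone map `θ : [m] ⟶ [n]` sends to one of the first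
`b` vertices of `[n]`. As these form an initial segment, it is the least `a` such that all vertices
`i ≥ a` are sent to vertices `≥ b`. -/
def cut {m n : SimplexCategory} (θ : m ⟶ n) (b : ℕ) : ℕ :=
  sInf {a : ℕ | ∀ i : Fin (m.len + 1), a ≤ (i : ℕ) → b ≤ (θ.toOrderHom i : ℕ)}

theorem lt_cut_iff {m n : SimplexCategory} (θ : m ⟶ n) (b : ℕ) (i : Fin (m.len + 1)) :
    (i : ℕ) < cut θ b ↔ (θ.toOrderHom i : ℕ) < b := by
  have hne : {a : ℕ | ∀ i : Fin (m.len + 1), a ≤ (i : ℕ) → b ≤ (θ.toOrderHom i : ℕ)}.Nonempty :=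
    ⟨m.len + 1, fun i hi ↦ by omega⟩
  constructor
  · intro h
    by_contra! hb
    refine Nat.notMem_of_lt_sInf h (fun j hj ↦ hb.trans ?_)
    exact θ.toOrderHom.monotone (Fin.le_def.2 hj)
  · intro h
    by_contra! hc
    exact absurd (Nat.sInf_mem hne i hc) (by omega)

/-- The monotone map induced by `θ` from the last `l' + 1` vertices of `[m]` to the last `l + 1`
vertices of `[n]`. -/
def tail {m n : SimplexCategory} (θ : m ⟶ n) (a l' b l : ℕ) (ha : a + l' = m.len)
    (hb : b + l = n.len)
    (_h : ∀ i : Fin (m.len + 1), a ≤ (i : ℕ) → b ≤ (θ.toOrderHom i : ℕ)) :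
    SimplexCategory.mk l' ⟶ SimplexCategory.mk l :=
  SimplexCategory.Hom.mk
    { toFun i := ⟨(θ.toOrderHom ⟨a + i, by have := i.2; simp at this; omega⟩ : ℕ) - b, by
        have := (θ.toOrderHom ⟨a + i, by have := i.2; simp at this; omega⟩).2
        simp; omega⟩
      monotone' i j hij := by
        refine Fin.le_def.2 (Nat.sub_le_sub_right (Fin.le_def.1 (θ.toOrderHom.monotone ?_)) b)
        exact Fin.le_def.2 (Nat.add_le_add_left (Fin.le_def.1 hij) a) }

/-- The simplicial structure maps of the cone: `θ^*(c_n) = c_m`, and `θ^*` of a simplex `σ` of `X`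
preceded by `b` copies of the cone point is `(tail θ)^* σ` preceded by `cut θ b` copies of the cone
point (or `c_m`, if all vertices of `[m]` are sent to the cone point). -/
def ConeSimplex.map {X : SSet.{0}} {m n : SimplexCategory} (θ : m ⟶ n) :
    ConeSimplex X n.len → ConeSimplex X m.len
  | .apex => .apex
  | .part b l hb σ =>
    if h : cut θ b ≤ m.len then
      .part (cut θ b) (m.len - cut θ b) (by omega)
        (X.map (tail θ (cut θ b) (m.len - cut θ b) b l (by omega) hb
          (fun i hi ↦ not_lt.1 (mt (lt_cut_iff θ b i).2 (not_lt.2 hi)))).op σ)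
    else .apex

theorem ConeSimplex.map_part_of_le {X : SSet.{0}} {m n : SimplexCategory} (θ : m ⟶ n)
    (b l : ℕ) (hb : b + l = n.len) (σ : X.obj (op (.mk l))) (a l' : ℕ) (ha : a + l' = m.len)
    (h : ∀ i : Fin (m.len + 1), (i : ℕ) < a ↔ (θ.toOrderHom i : ℕ) < b) :
    ConeSimplex.map θ (.part b l hb σ) = .part a l' ha
      (X.map (tail θ a l' b l ha hb (fun i hi ↦ not_lt.1 (mt (h i).2 (not_lt.2 hi)))).op σ) := by
  have hcut : cut θ b = a := by
    have h1 := (lt_cut_iff θ b ⟨a, by omega⟩).trans (h ⟨a, by omega⟩).symm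
    simp only [lt_self_iff_false, iff_false, not_lt] at h1
    refine le_antisymm h1 (not_lt.1 fun hlt ↦ ?_)
    have h2 := (lt_cut_iff θ b ⟨cut θ b, by omega⟩).trans (h ⟨cut θ b, by omega⟩).symm
    simp only [lt_self_iff_false, false_iff, not_lt] at h2
    omega
  obtain rfl : l' = m.len - a := by omega
  subst hcut
  rw [ConeSimplex.map, dif_pos (by omega)]

theorem ConeSimplex.map_part_of_forall_lt {X : SSet.{0}} {m n : SimplexCategory} (θ : m ⟶ n)
    (b l : ℕ) (hb : b + l = n.len) (σ : X.obj (op (.mk l)))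
    (h : ∀ i : Fin (m.len + 1), (θ.toOrderHom i : ℕ) < b) :
    ConeSimplex.map θ (.part b l hb σ) = .apex := by
  have := (lt_cut_iff θ b (Fin.last _)).2 (h _)
  rw [ConeSimplex.map, dif_neg (by simpa using this)]

theorem ConeSimplex.map_id {X : SSet.{0}} {n : SimplexCategory} (x : ConeSimplex X n.len) :
    ConeSimplex.map (𝟙 n) x = x := by
  cases x with
  | apex => rfl
  | part b l hb σ =>
    rw [ConeSimplex.map_part_of_le (𝟙 n) b l hb σ b l hb (fun i ↦ by simp)]
    have : tail (𝟙 n) b l b l hb hb (fun i hi ↦ by simpa using hi) = 𝟙 (SimplexCategory.mk l) := by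
      ext i
      simp [tail]
    rw [this]
    simp

theorem ConeSimplex.map_comp {X : SSet.{0}} {m n r : SimplexCategory} (θ : m ⟶ n) (η : n ⟶ r)
    (x : ConeSimplex X r.len) :
    ConeSimplex.map (θ ≫ η) x = ConeSimplex.map θ (ConeSimplex.map η x) := by
  cases x with
  | apex => rfl
  | part b l hb σ =>
    by_cases h : cut η b ≤ n.len
    · have hη := ConeSimplex.map_part_of_le η b l hb σ (cut η b) (n.len - cut η b) (by omega)
        (fun i ↦ lt_cut_iff η b i)
      rw [hη]
      by_cases h' : cut θ (cut η b) ≤ m.len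
      · rw [ConeSimplex.map_part_of_le θ _ _ _ _ (cut θ (cut η b)) (m.len - cut θ (cut η b))
            (by omega) (fun i ↦ lt_cut_iff θ _ i),
          ConeSimplex.map_part_of_le (θ ≫ η) b l hb σ (cut θ (cut η b))
            (m.len - cut θ (cut η b)) (by omega)
            (fun i ↦ by rw [lt_cut_iff, lt_cut_iff]; rfl)]
        rw [← comp_apply, ← Functor.map_comp, ← op_comp]
        congr 3
        refine congrArg X.map ?_
        apply Quiver.Hom.unop_inj
        ext i
        have key : cut η b ≤ (θ.toOrderHom ⟨cut θ (cut η b) + i, by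
            have := i.2; simp at this; omega⟩ : ℕ) :=
          not_lt.1 (mt (lt_cut_iff θ _ _).2 (by simp))
        refine congrArg (fun j ↦ (η.toOrderHom j : ℕ) - b) (Fin.ext ?_)
        exact (Nat.add_sub_cancel' key).symm
      · have hall : ∀ i, (θ.toOrderHom i : ℕ) < cut η b := fun i ↦
          (lt_cut_iff θ _ i).1 (by omega)
        rw [ConeSimplex.map_part_of_forall_lt θ _ _ _ _ hall,
          ConeSimplex.map_part_of_forall_lt (θ ≫ η) _ _ _ _
            (fun i ↦ (lt_cut_iff η b _).1 (hall i))]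
    · have hall : ∀ i, (η.toOrderHom i : ℕ) < b := fun i ↦ (lt_cut_iff η _ i).1 (by omega)
      rw [ConeSimplex.map_part_of_forall_lt η _ _ _ _ hall,
        ConeSimplex.map_part_of_forall_lt (θ ≫ η) _ _ _ _ (fun i ↦ hall _)]
      rfl

/-- The simplicial set `Cone(X)`. -/
def cone (X : SSet.{0}) : SSet.{0} where
  obj n := ConeSimplex X n.unop.len
  map θ := ↾(ConeSimplex.map θ.unop)
  map_id n := by
    ext x
    exact ConeSimplex.map_id x
  map_comp θ η := by
    ext x
    exact ConeSimplex.map_comp η.unop θ.unop x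

/-- The inclusion `X ⊂ Cone(X)`. -/
def coneIncl (X : SSet.{0}) : X ⟶ cone X where
  app n := ↾fun σ ↦ (ConeSimplex.part 0 n.unop.len (by omega) σ : ConeSimplex X n.unop.len)
  naturality m n θ := by
    ext σ
    refine Eq.symm ((ConeSimplex.map_part_of_le θ.unop 0 m.unop.len (Nat.zero_add _) σ 0 n.unop.len
      (Nat.zero_add _) (by simp)).trans ?_)
    have : tail θ.unop 0 n.unop.len 0 m.unop.len (Nat.zero_add _) (Nat.zero_add _)
        (by simp) = θ.unop := by
      ext i
      simp [tail]
    rw [this]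
    rfl

/-! ### One-dimensional simplicial sets -/

/-- A directed multigraph: every edge `e` runs from `src e` to `tgt e`. -/
structure MultiDigraph where
  Vertex : Type
  Edge : Type
  src : Edge → Vertex
  tgt : Edge → Vertex

/-- The `n`-simplices of the one-dimensional simplicial set with vertices `G.Vertex` and generating
edges `G.Edge`: the degenerate simplices on the vertices, and for each edge `e` the pull-backs of
`e` along the surjective monotone maps `[n] → [1]`. -/
inductive GraphSimplex (G : MultiDigraph) (n : ℕ) : Type
  | vertex (v : G.Vertex) : GraphSimplex G n
  | edge (e : G.Edge) (χ : Fin (n + 1) →o Fin 2) (hχ : Function.Surjective χ) : GraphSimplex G n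

open scoped Classical in
/-- The pull-back of the edge `e` along an arbitrary monotone map `χ : [n] → [1]`. If `χ` is
constant, this is the degenerate simplex on `d₁ e = src e` or `d₀ e = tgt e`. -/
def GraphSimplex.pullEdge {G : MultiDigraph} {n : ℕ} (e : G.Edge) (χ : Fin (n + 1) →o Fin 2) :
    GraphSimplex G n :=
  if hχ : Function.Surjective χ then .edge e χ hχ
  else .vertex (if χ 0 = 0 then G.src e else G.tgt e)

/-- The simplicial structure maps of the one-dimensional simplicial set of `G`. -/
def GraphSimplex.map {G : MultiDigraph} {m n : SimplexCategory} (θ : m ⟶ n) :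
    GraphSimplex G n.len → GraphSimplex G m.len
  | .vertex v => .vertex v
  | .edge e χ _ => .pullEdge e (χ.comp θ.toOrderHom)

theorem GraphSimplex.map_pullEdge {G : MultiDigraph} {m n : SimplexCategory} (θ : m ⟶ n)
    (e : G.Edge) (χ : Fin (n.len + 1) →o Fin 2) :
    GraphSimplex.map θ (.pullEdge e χ) = .pullEdge e (χ.comp θ.toOrderHom) := by
  by_cases hχ : Function.Surjective χ
  · rw [GraphSimplex.pullEdge, dif_pos hχ]
    rfl
  · have hχ' : ¬ Function.Surjective (χ.comp θ.toOrderHom) := fun h ↦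
      hχ (Function.Surjective.of_comp (g := θ.toOrderHom) h)
    have hconst : χ (θ.toOrderHom 0) = χ 0 := by
      by_contra hne
      have h1 : χ 0 ≤ χ (θ.toOrderHom 0) := χ.monotone (Fin.zero_le _)
      refine hχ (fun y ↦ ?_)
      by_cases hy : y = χ 0
      · exact ⟨0, hy.symm⟩
      · exact ⟨θ.toOrderHom 0, by omega⟩
    rw [GraphSimplex.pullEdge, GraphSimplex.pullEdge, dif_neg hχ, dif_neg hχ']
    simp [GraphSimplex.map, hconst]

/-- The one-dimensional simplicial set with vertices `G.Vertex` and generating `1`-simplices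
`G.Edge`, subject to the relations `d₁ e = src e` and `d₀ e = tgt e`. -/
def graphSpace (G : MultiDigraph) : SSet.{0} where
  obj n := GraphSimplex G n.unop.len
  map θ := ↾(GraphSimplex.map θ.unop)
  map_id n := by
    ext x
    cases x with
    | vertex v => rfl
    | edge e χ hχ => exact dif_pos hχ
  map_comp θ η := by
    ext x
    cases x with
    | vertex v => rfl
    | edge e χ hχ => exact (GraphSimplex.map_pullEdge η.unop e (χ.comp θ.unop.toOrderHom)).symm

/-- The generating `1`-simplex of `graphSpace G` given by the edge `e`. -/
def genEdge {G : MultiDigraph} (e : G.Edge) : (graphSpace G).obj (op (.mk 1)) :=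
  GraphSimplex.edge e OrderHom.id Function.surjective_id

/-! ### Circles and the circle inequalities -/

/-- The graph underlying the `N`-circle: vertices and edges are indexed by `Fin N`, the edge `τ_i`
joins the vertices `i` and `i + 1` (cyclically), and `o i` says whether it runs from `i + 1` to `i`
or from `i` to `i + 1`. For `N = 1` this is a loop. -/
def circleGraph (N : ℕ) [NeZero N] (o : Fin N → Bool) : MultiDigraph where
  Vertex := Fin N
  Edge := Fin N
  src i := if o i then i + 1 else i
  tgt i := if o i then i else i + 1

/-- The `N`-circle space `C_N` with edge directions `o`. -/
abbrev circle (N : ℕ) [NeZero N] (o : Fin N → Bool) : SSet.{0} := graphSpace (circleGraph N o)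

/-- The `N`-circle inequalities: `0 ≤ N - 2 + ∑ i, (-1)^{a_i} τ̄_i` for all `a ∈ ℤ₂^N` such that
`∑ i, a_i = N + 1` modulo `2`. -/
def CircleInequalities {N : ℕ} [NeZero N] {o : Fin N → Bool} (q : SDist (circle N o) NZ2) : Prop :=
  ∀ a : Fin N → ZMod 2, ∑ i, a i = (N : ZMod 2) + 1 →
    0 ≤ (N : ℝ) - 2 + ∑ i : Fin N, (-1 : ℝ) ^ (a i).val *
      expectation q (genEdge (G := circleGraph N o) i)

/-! ### Flower scenarios -/

/-- The vertices of `X(N_1, …, N_k)`: the two common end points `v` and `w` of the lines, and the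
interior points at positions `0 < j < N_i` of the lines `L_{N_i}`. -/
inductive FlowerVertex {k : ℕ} (N : Fin k → ℕ) : Type
  | v : FlowerVertex N
  | w : FlowerVertex N
  | inner (i : Fin k) (j : ℕ) (hj : 0 < j ∧ j < N i) : FlowerVertex N

/-- The image in `X(N_1, …, N_k)` of the point at position `j ∈ {0, …, N_i}` of the line `L_{N_i}`:
all initial points are glued to `v`, all final points are glued to `w`. -/
def linePoint {k : ℕ} (N : Fin k → ℕ) (i : Fin k) (j : Fin (N i + 1)) : FlowerVertex N :=
  if h0 : (j : ℕ) = 0 then .v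
  else if h1 : (j : ℕ) = N i then .w
  else .inner i j ⟨Nat.pos_of_ne_zero h0, lt_of_le_of_ne (Nat.lt_succ_iff.1 j.2) h1⟩

/-- The graph underlying `X(N_1, …, N_k)`: the edge `⟨i, j⟩` is the `j`-th edge of `L_{N_i}`; it
joins the points at positions `j` and `j + 1`, and `o i j` says whether it runs from `j + 1` to `j`
or from `j` to `j + 1`. -/
def flowerGraph {k : ℕ} (N : Fin k → ℕ) (o : ∀ i, Fin (N i) → Bool) : MultiDigraph where
  Vertex := FlowerVertex N
  Edge := Σ i, Fin (N i)
  src e := if o e.1 e.2 then linePoint N e.1 e.2.succ else linePoint N e.1 e.2.castSucc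
  tgt e := if o e.1 e.2 then linePoint N e.1 e.2.castSucc else linePoint N e.1 e.2.succ

/-- The simplicial set `X(N_1, …, N_k)` with edge directions `o`. Its cone is a flower scenario. -/
abbrev flowerBase {k : ℕ} (N : Fin k → ℕ) (o : ∀ i, Fin (N i) → Bool) : SSet.{0} :=
  graphSpace (flowerGraph N o)

end SimplicialContextuality

end

noncomputable section

namespace SimplicialContextuality

open Convexity

/-! An assignment on the cone restricts to each edge of the graph as the sum of its values on the
cone edges at the two end points, and every function on the vertices arises this way. So `p` is
non-contextual iff there is a joint law of signs at the vertices with the means and edge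
correlations read off from `p`: these moments determine `p` on the triangles over edges
(`HasMoments.map_eq`), and the triangles generate the cone (`nonContextual_of_hasMoments`).

Necessity: the circle inequalities are linear in the distribution, and for one assignment they
follow from a parity count, since the values around a circle sum to zero
(`circleInequalities_theta`).

Sufficiency: add a chord from `v` to `w` with an unknown correlation `t`. Every requirement on `t`
is a bound from one side, so it suffices to compare each lower bound with each upper one. Two bounds
from different petals are compatible exactly by the inequalities of the circle formed by these
petals; all other pairs are automatic (`exists_common_diagonal`). Each petal with its chord is then
cut by diagonals, found in the same way (`ClosesUp.exists_diagonal`), into triangles that have a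
joint law (`exists_triple`). Triangles are glued along diagonals, and petals along the pair `(v,
w)`, by conditionally independent couplings (`exists_amalgam`). -/

/-! ### Expectation values of finitely supported distributions -/

/-- The expectation value of a real function with respect to a distribution. -/
def mean {U : Type} (p : Dist U) (f : U → ℝ) : ℝ := p.weights.sum fun u w ↦ (w : ℝ) * f u

theorem mean_map {U W : Type} (p : Dist U) (φ : U → W) (f : W → ℝ) :
    mean (p.map φ) f = mean p (fun u ↦ f (φ u)) := by
  unfold mean
  rw [StdSimplex.weights_map, Finsupp.sum_mapDomain_index] <;> simp [add_mul]

theorem mean_congr {U : Type} {p : Dist U} {f g : U → ℝ}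
    (h : ∀ u, p.weights u ≠ 0 → f u = g u) : mean p f = mean p g :=
  Finsupp.sum_congr fun u hu ↦ by rw [h u (Finsupp.mem_support_iff.1 hu)]

theorem mean_const {U : Type} (p : Dist U) (c : ℝ) : mean p (fun _ ↦ c) = c := by
  have h := congrArg (fun r : NNReal ↦ (r : ℝ)) p.total
  simp only [Finsupp.sum, NNReal.coe_sum, NNReal.coe_one] at h
  simp only [mean, Finsupp.sum, ← Finset.sum_mul, h, one_mul]

theorem mean_add {U : Type} (p : Dist U) (f g : U → ℝ) :
    mean p (fun u ↦ f u + g u) = mean p f + mean p g := by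
  simp [mean, mul_add, Finsupp.sum_add]

theorem mean_const_mul {U : Type} (p : Dist U) (c : ℝ) (f : U → ℝ) :
    mean p (fun u ↦ c * f u) = c * mean p f := by
  simp only [mean, Finsupp.sum, Finset.mul_sum]
  exact Finset.sum_congr rfl fun u _ ↦ by ring

theorem mean_sum {U ι : Type} (p : Dist U) (s : Finset ι) (f : ι → U → ℝ) :
    mean p (fun u ↦ ∑ i ∈ s, f i u) = ∑ i ∈ s, mean p (f i) := by
  simp only [mean, Finsupp.sum, Finset.mul_sum]
  exact Finset.sum_comm

theorem mean_nonneg {U : Type} (p : Dist U) {f : U → ℝ} (h : ∀ u, 0 ≤ f u) : 0 ≤ mean p f :=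
  Finset.sum_nonneg fun u _ ↦ mul_nonneg (NNReal.coe_nonneg _) (h u)

theorem mean_eq_sum {U : Type} [Fintype U] (p : Dist U) (f : U → ℝ) :
    mean p f = ∑ u, (p.weights u : ℝ) * f u :=
  Finsupp.sum_fintype _ _ (by simp)

/-- The distribution on a finite type with given real weights. -/
def distOfWeights {U : Type} [Fintype U] (w : U → ℝ) (h0 : ∀ u, 0 ≤ w u) (h1 : ∑ u, w u = 1) :
    Dist U where
  weights := Finsupp.equivFunOnFinite.symm fun u ↦ ⟨w u, h0 u⟩
  nonneg := fun _ ↦ zero_le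
  total := by
    rw [Finsupp.sum_fintype _ _ (by simp)]
    refine NNReal.coe_injective (Eq.trans ?_ h1)
    rw [NNReal.coe_sum]
    rfl

theorem mean_distOfWeights {U : Type} [Fintype U] (w : U → ℝ) (h0 : ∀ u, 0 ≤ w u)
    (h1 : ∑ u, w u = 1) (f : U → ℝ) : mean (distOfWeights w h0 h1) f = ∑ u, w u * f u := by
  rw [mean_eq_sum]
  rfl

theorem map_injective {U W : Type} {f : U → W} (hf : Function.Injective f) :
    Function.Injective (fun p : Dist U ↦ p.map f) := fun _ _ h ↦
  StdSimplex.ext (Finsupp.mapDomain_injective hf (congrArg StdSimplex.weights h))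

/-! ### Amalgamation -/

open scoped Classical in
theorem weights_map_eq_sum {U W : Type} (p : Dist U) (f : U → W) (c : W) :
    (p.map f).weights c = ∑ u ∈ p.weights.support, if f u = c then p.weights u else 0 := by
  simp [StdSimplex.weights_map, Finsupp.mapDomain, Finsupp.sum, Finsupp.single_apply]

open scoped Classical in
/-- The weights of the amalgamation of two distributions over a common image, in which the two
factors are conditionally independent. -/
def amalgamWeights {U W C : Type} (p : Dist U) (q : Dist W) (f : U → C) (g : W → C) :
    U × W →₀ NNReal :=
  Finsupp.onFinset (p.weights.support ×ˢ q.weights.support)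
    (fun x ↦ if g x.2 = f x.1 then
      p.weights x.1 * q.weights x.2 / (p.map f).weights (f x.1) else 0)
    (fun x hx ↦ by
      simp only [ne_eq, ite_eq_right_iff, not_forall, div_eq_zero_iff, mul_eq_zero, not_or] at hx
      simp [hx.2.1.1, hx.2.1.2])

open scoped Classical in
theorem le_weights_map {U W : Type} (p : Dist U) (f : U → W) (u : U) :
    p.weights u ≤ (p.map f).weights (f u) := by
  rw [weights_map_eq_sum]
  by_cases hu : u ∈ p.weights.support
  · refine le_trans ?_ (Finset.single_le_sum (fun _ _ ↦ zero_le) hu)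
    simp
  · simp [Finsupp.notMem_support_iff.1 hu]

/-- The weights of `q` over the fibre of `f u` add up to the common image weight, which cancels the
denominator. If that weight vanishes, so does `p.weights u`. -/
theorem amalgamWeights_sum_right {U W C : Type} (p : Dist U) (q : Dist W) (f : U → C) (g : W → C)
    (h : p.map f = q.map g) (u : U) :
    ∑ w ∈ q.weights.support, amalgamWeights p q f g (u, w) = p.weights u := by
  classical
  by_cases hu : p.weights u = 0
  · simp [amalgamWeights, hu]
  have hne : (p.map f).weights (f u) ≠ 0 := fun h0 ↦
    hu (le_antisymm (h0 ▸ le_weights_map p f u) zero_le)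
  have hs : (∑ w ∈ q.weights.support, if g w = f u then q.weights w else 0) =
      (p.map f).weights (f u) := by
    rw [h, weights_map_eq_sum]
  calc _ = ∑ w ∈ q.weights.support, p.weights u / (p.map f).weights (f u) *
        (if g w = f u then q.weights w else 0) := by
        refine Finset.sum_congr rfl fun w _ ↦ ?_
        simp only [amalgamWeights, Finsupp.onFinset_apply]
        split_ifs
        · rw [mul_div_right_comm]
        · simp
    _ = _ := by rw [← Finset.mul_sum, hs, div_mul_cancel₀ _ hne]

theorem amalgamWeights_sum_left {U W C : Type} (p : Dist U) (q : Dist W) (f : U → C) (g : W → C)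
    (h : p.map f = q.map g) (w : W) :
    ∑ u ∈ p.weights.support, amalgamWeights p q f g (u, w) = q.weights w := by
  classical
  rw [← amalgamWeights_sum_right q p g f h.symm w]
  refine Finset.sum_congr rfl fun u _ ↦ ?_
  simp only [amalgamWeights, Finsupp.onFinset_apply]
  by_cases hc : g w = f u
  · rw [if_pos hc, if_pos hc.symm, h, hc, mul_comm]
  · rw [if_neg hc, if_neg (Ne.symm hc)]

/-- Two distributions with the same image in `C` have a coupling that is supported on the fibre
product over `C`. -/
theorem exists_amalgam {U W C : Type} (p : Dist U) (q : Dist W) (f : U → C) (g : W → C)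
    (h : p.map f = q.map g) :
    ∃ r : Dist (U × W), r.map Prod.fst = p ∧ r.map Prod.snd = q ∧
      ∀ x, r.weights x ≠ 0 → f x.1 = g x.2 := by
  classical
  have hsum {M : Type} [AddCommMonoid M] (k : U × W → NNReal → M) (hk : ∀ x, k x 0 = 0) :
      (amalgamWeights p q f g).sum k = ∑ u ∈ p.weights.support, ∑ w ∈ q.weights.support,
        k (u, w) (amalgamWeights p q f g (u, w)) := by
    rw [← Finset.sum_product']
    exact Finsupp.sum_of_support_subset _ Finsupp.support_onFinset_subset _ (fun x _ ↦ hk x)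
  have ht : (amalgamWeights p q f g).sum (fun _ r ↦ r) = 1 := by
    rw [hsum _ (fun _ ↦ rfl)]
    simp only [amalgamWeights_sum_right p q f g h]
    exact p.total
  refine ⟨⟨amalgamWeights p q f g, fun _ ↦ zero_le, ht⟩, ?_, ?_, fun x hx ↦ ?_⟩
  · refine StdSimplex.ext ?_
    rw [StdSimplex.weights_map, Finsupp.mapDomain, hsum _ (by simp)]
    simp only [← Finsupp.single_finsetSum, amalgamWeights_sum_right p q f g h]
    exact Finsupp.sum_single _
  · refine StdSimplex.ext ?_
    rw [StdSimplex.weights_map, Finsupp.mapDomain, hsum _ (by simp), Finset.sum_comm]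
    simp only [← Finsupp.single_finsetSum, amalgamWeights_sum_left p q f g h]
    exact Finsupp.sum_single _
  · by_contra hne
    exact hx (if_neg (Ne.symm hne))

/-! ### Moments of pairs of `ℤ₂`-valued random variables -/

/-- The sign `(-1)^a`. -/
def sgn (a : ZMod 2) : ℝ := (-1) ^ a.val

theorem zmod_two_cases (a : ZMod 2) : a = 0 ∨ a = 1 := by
  revert a; decide

@[simp] theorem sgn_zero : sgn 0 = 1 := by simp [sgn]

@[simp] theorem sgn_one : sgn 1 = -1 := by simp [sgn, ZMod.val_one]

theorem sgn_add (a b : ZMod 2) : sgn (a + b) = sgn a * sgn b := by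
  rcases zmod_two_cases a with rfl | rfl <;> rcases zmod_two_cases b with rfl | rfl <;>
    simp [show (1 + 1 : ZMod 2) = 0 from rfl]

theorem sgn_add_one (a : ZMod 2) : sgn (a + 1) = -sgn a := by
  rw [sgn_add, sgn_one, mul_neg_one]

theorem sum_zmod_two {M : Type} [AddCommMonoid M] (f : ZMod 2 → M) : ∑ a, f a = f 0 + f 1 :=
  Fin.sum_univ_two f

/-- The random variables `f` and `g` have expectation values `a`, `b` and correlation `c`. -/
structure HasMoments {U : Type} (p : Dist U) (f g : U → ZMod 2) (a b c : ℝ) : Prop where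
  left : mean p (fun u ↦ sgn (f u)) = a
  right : mean p (fun u ↦ sgn (g u)) = b
  corr : mean p (fun u ↦ sgn (f u + g u)) = c

theorem hasMoments_map {U W : Type} {p : Dist U} {φ : U → W} {f g : W → ZMod 2} {a b c : ℝ} :
    HasMoments (p.map φ) f g a b c ↔
      HasMoments p (fun u ↦ f (φ u)) (fun u ↦ g (φ u)) a b c := by
  constructor <;> rintro ⟨h1, h2, h3⟩
  · exact ⟨(mean_map p φ _).symm.trans h1, (mean_map p φ _).symm.trans h2, (mean_map p φ _).symm.trans h3⟩
  · exact ⟨(mean_map p φ _).trans h1, (mean_map p φ _).trans h2, (mean_map p φ _).trans h3⟩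

theorem HasMoments.congr {U : Type} {p : Dist U} {f g f' g' : U → ZMod 2} {a b c : ℝ}
    (h : HasMoments p f g a b c) (hf : ∀ u, p.weights u ≠ 0 → f u = f' u)
    (hg : ∀ u, p.weights u ≠ 0 → g u = g' u) : HasMoments p f' g' a b c where
  left := by rw [← h.left]; exact mean_congr fun u hu ↦ by rw [hf u hu]
  right := by rw [← h.right]; exact mean_congr fun u hu ↦ by rw [hg u hu]
  corr := by rw [← h.corr]; exact mean_congr fun u hu ↦ by rw [hf u hu, hg u hu]

theorem HasMoments.symm {U : Type} {p : Dist U} {f g : U → ZMod 2} {a b c : ℝ}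
    (h : HasMoments p f g a b c) : HasMoments p g f b a c :=
  ⟨h.right, h.left, by simpa only [add_comm] using h.corr⟩

/-- Fourier inversion on `ℤ₂ × ℤ₂`: total mass, two means and one correlation are all the Fourier
coefficients. -/
theorem HasMoments.weights_eq {p : Dist (ZMod 2 × ZMod 2)} {a b c : ℝ}
    (h : HasMoments p Prod.fst Prod.snd a b c) (x : ZMod 2 × ZMod 2) :
    (p.weights x : ℝ) = (1 + sgn x.1 * a + sgn x.2 * b + sgn (x.1 + x.2) * c) / 4 := by
  obtain ⟨rfl, rfl, rfl⟩ := h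
  have h1 := mean_const p 1
  simp only [mean_eq_sum, Fintype.sum_prod_type, sum_zmod_two] at h1 ⊢
  obtain ⟨x, y⟩ := x
  rcases zmod_two_cases x with rfl | rfl <;> rcases zmod_two_cases y with rfl | rfl <;>
    simp [show (1 + 1 : ZMod 2) = 0 from rfl] <;> linarith

/-- The joint distribution of two `ℤ₂`-valued random variables is determined by its moments. -/
theorem HasMoments.map_eq {U W : Type} {p : Dist U} {q : Dist W} {f g : U → ZMod 2}
    {f' g' : W → ZMod 2} {a b c : ℝ} (hp : HasMoments p f g a b c) (hq : HasMoments q f' g' a b c) :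
    p.map (fun u ↦ (f u, g u)) = q.map (fun w ↦ (f' w, g' w)) := by
  refine StdSimplex.ext (Finsupp.ext fun x ↦ NNReal.coe_injective ?_)
  rw [(hasMoments_map (φ := fun u ↦ (f u, g u)).2 hp).weights_eq,
    (hasMoments_map (φ := fun w ↦ (f' w, g' w)).2 hq).weights_eq]

/-- The Fréchet bounds for the correlation `c` of two signs with expectation values `a`, `b`. -/
def Frechet (a b c : ℝ) : Prop := |a + b| ≤ 1 + c ∧ |a - b| ≤ 1 - c

/-- The four Fréchet bounds say that the four weights given by Fourier inversion are nonnegative;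
`exists_pair` is the converse. -/
theorem HasMoments.frechet {U : Type} {p : Dist U} {f g : U → ZMod 2} {a b c : ℝ}
    (h : HasMoments p f g a b c) : Frechet a b c := by
  have hw := fun x ↦ ((hasMoments_map (φ := fun u ↦ (f u, g u)) (f := Prod.fst)
    (g := Prod.snd)).2 h).weights_eq x ▸ NNReal.coe_nonneg _
  have h00 := hw (0, 0)
  have h01 := hw (0, 1)
  have h10 := hw (1, 0)
  have h11 := hw (1, 1)
  simp [show (1 + 1 : ZMod 2) = 0 from rfl] at h00 h01 h10 h11
  constructor <;> rw [abs_le] <;> constructor <;> linarith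

theorem Frechet.symm {a b c : ℝ} (h : Frechet a b c) : Frechet b a c :=
  ⟨by rw [add_comm]; exact h.1, by rw [abs_sub_comm]; exact h.2⟩

theorem Frechet.nonneg {a b c : ℝ} (h : Frechet a b c) (x y : ZMod 2) :
    0 ≤ 1 + sgn x * a + sgn y * b + sgn (x + y) * c := by
  obtain ⟨h1, h2⟩ := h
  rw [abs_le] at h1 h2
  rcases zmod_two_cases x with rfl | rfl <;> rcases zmod_two_cases y with rfl | rfl <;>
    simp [show (1 + 1 : ZMod 2) = 0 from rfl] <;> linarith

theorem exists_pair {a b c : ℝ} (h : Frechet a b c) :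
    ∃ R : Dist (ZMod 2 × ZMod 2), HasMoments R Prod.fst Prod.snd a b c := by
  refine ⟨distOfWeights (fun x ↦ (1 + sgn x.1 * a + sgn x.2 * b + sgn (x.1 + x.2) * c) / 4)
    (fun x ↦ div_nonneg (h.nonneg _ _) (by norm_num)) ?_, ?_, ?_, ?_⟩ <;>
  simp [mean_distOfWeights, Fintype.sum_prod_type, sum_zmod_two,
    show (1 + 1 : ZMod 2) = 0 from rfl] <;> ring

/-- Three signs with expectation values `a`, `b`, `c` and pairwise correlations `ab`, `bc`, `ac`
have a joint distribution as soon as all Fréchet bounds and the inequalities of the triangle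
hold. -/
theorem exists_triple {a b c ab bc ac : ℝ} (h1 : Frechet a b ab) (h2 : Frechet b c bc)
    (h3 : Frechet a c ac) (h4 : Frechet bc ac ab) :
    ∃ T : Dist (ZMod 2 × ZMod 2 × ZMod 2), HasMoments T Prod.fst (fun x ↦ x.2.1) a b ab ∧
      HasMoments T (fun x ↦ x.2.1) (fun x ↦ x.2.2) b c bc ∧
      HasMoments T Prod.fst (fun x ↦ x.2.2) a c ac := by
  set w : ZMod 2 × ZMod 2 × ZMod 2 → ℝ := fun x ↦ 1 + sgn x.1 * a + sgn x.2.1 * b +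
    sgn x.2.2 * c + sgn (x.1 + x.2.1) * ab + sgn (x.2.1 + x.2.2) * bc + sgn (x.1 + x.2.2) * ac
    with hw
  have e : (1 + 1 : ZMod 2) = 0 := rfl
  -- The only Fourier coefficient left free is the triple correlation `z`. Nonnegativity of the
  -- eight weights bounds it below at even points and above at odd points.
  obtain ⟨z, hz⟩ : ∃ z, ∀ x, 0 ≤ w x + sgn (x.1 + x.2.1 + x.2.2) * z := by
    obtain ⟨z, hl, hu⟩ := exists_between_of_forall_le
      (s := {l | ∃ x : ZMod 2 × ZMod 2 × ZMod 2, x.1 + x.2.1 + x.2.2 = 0 ∧ l = -w x})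
      (t := {u | ∃ x : ZMod 2 × ZMod 2 × ZMod 2, x.1 + x.2.1 + x.2.2 = 1 ∧ u = w x})
      ⟨_, (0, 0, 0), rfl, rfl⟩ ⟨_, (1, 0, 0), rfl, rfl⟩ (by
        rintro _ ⟨⟨x, y, z⟩, hx, rfl⟩ _ ⟨⟨x', y', z'⟩, hx', rfl⟩
        -- An even and an odd point differ in one or in all three coordinates. In the first case the
        -- sum of the two values is twice a pair marginal up to scaling, hence a Fréchet bound; in
        -- the second all means cancel and a triangle inequality from `h4` remains.
        rw [neg_le_iff_add_nonneg]
        obtain ⟨h11, h12⟩ := h1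
        obtain ⟨h21, h22⟩ := h2
        obtain ⟨h31, h32⟩ := h3
        obtain ⟨h41, h42⟩ := h4
        rw [abs_le] at *
        simp only [hw]
        rcases zmod_two_cases x with rfl | rfl <;> rcases zmod_two_cases y with rfl | rfl <;>
        rcases zmod_two_cases z with rfl | rfl <;> rcases zmod_two_cases x' with rfl | rfl <;>
        rcases zmod_two_cases y' with rfl | rfl <;> rcases zmod_two_cases z' with rfl | rfl <;>
        simp [e] at hx hx' ⊢ <;> linarith)
    refine ⟨z, fun x ↦ ?_⟩
    rcases zmod_two_cases (x.1 + x.2.1 + x.2.2) with hx | hx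
    · have := hl ⟨x, hx, rfl⟩
      rw [hx, sgn_zero]
      linarith
    · have := hu ⟨x, hx, rfl⟩
      rw [hx, sgn_one]
      linarith
  refine ⟨distOfWeights (fun x ↦ (w x + sgn (x.1 + x.2.1 + x.2.2) * z) / 8)
    (fun x ↦ div_nonneg (hz _) (by norm_num)) ?_, ⟨?_, ?_, ?_⟩, ⟨?_, ?_, ?_⟩, ⟨?_, ?_, ?_⟩⟩ <;>
  simp [mean_distOfWeights, Fintype.sum_prod_type, sum_zmod_two, hw, e] <;> ring

theorem abs_sgn (s : ZMod 2) : |sgn s| = 1 := by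
  rcases zmod_two_cases s with rfl | rfl <;> simp

/-! ### Lines with prescribed correlations -/

theorem Frechet.abs_left_le {a b c : ℝ} (h : Frechet a b c) : |a| ≤ 1 := by
  obtain ⟨h1, h2⟩ := h
  rw [abs_le] at *
  constructor <;> linarith

theorem Frechet.abs_corr_le {a b c : ℝ} (h : Frechet a b c) : |c| ≤ 1 := by
  have h1 := (abs_nonneg _).trans h.1
  have h2 := (abs_nonneg _).trans h.2
  rw [abs_le]
  constructor <;> linarith

theorem Frechet.abs_add_sgn_mul_le {a b c : ℝ} (h : Frechet a b c) (s : ZMod 2) :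
    |a + sgn s * b| ≤ 1 + sgn s * c := by
  rcases zmod_two_cases s with rfl | rfl
  · simpa using h.1
  · simpa [← sub_eq_add_neg] using h.2

/-- The sum of the terms `1 + (-1)^{a_i} x_i` over the first `n` edges of a line. -/
def pathSum (x : ℕ → ℝ) (n : ℕ) (a : ℕ → ZMod 2) : ℝ :=
  ∑ i ∈ Finset.range n, (1 + sgn (a i) * x i)

theorem pathSum_succ (x : ℕ → ℝ) (n : ℕ) (a : ℕ → ZMod 2) :
    pathSum x (n + 1) a = pathSum x n a + (1 + sgn (a n) * x n) :=
  Finset.sum_range_succ _ _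

theorem pathSum_congr {x : ℕ → ℝ} {n : ℕ} {a a' : ℕ → ZMod 2} (h : ∀ i < n, a i = a' i) :
    pathSum x n a = pathSum x n a' :=
  Finset.sum_congr rfl fun i hi ↦ by rw [h i (Finset.mem_range.1 hi)]

/-- Labels of different total parity differ at some edge, where the two terms `1 + x i` and `1 - x
i` already give `2`; all other terms are nonnegative. Hence bounds coming from one and the same line
never conflict. -/
theorem two_le_pathSum_add_pathSum {x : ℕ → ℝ} {n : ℕ} (hx : ∀ i < n, |x i| ≤ 1)
    {a a' : ℕ → ZMod 2} (h : ∑ i ∈ Finset.range n, a i ≠ ∑ i ∈ Finset.range n, a' i) :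
    2 ≤ pathSum x n a + pathSum x n a' := by
  obtain ⟨i, hi, hne⟩ : ∃ i ∈ Finset.range n, a i ≠ a' i := by
    by_contra! hc
    exact h (Finset.sum_congr rfl hc)
  have hnonneg (s : ZMod 2) (j : ℕ) (hj : j ∈ Finset.range n) : 0 ≤ 1 + sgn s * x j := by
    have := abs_le.1 (hx j (Finset.mem_range.1 hj))
    rcases zmod_two_cases s with rfl | rfl <;> simp <;> linarith
  rw [pathSum, pathSum, ← Finset.sum_add_distrib]
  refine le_trans (le_of_eq ?_) (Finset.single_le_sum
    (fun j hj ↦ add_nonneg (hnonneg _ j hj) (hnonneg _ j hj)) hi)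
  rcases zmod_two_cases (a i) with h1 | h1 <;> rcases zmod_two_cases (a' i) with h2 | h2 <;>
    simp [h1, h2] at hne ⊢ <;> ring

/-- The Fréchet bounds telescope: each edge replaces `e i` by `-sgn (a i) * e (i + 1)` at a cost of
at most `1 + sgn (a i) * x i`. The `n` minus signs account for the summand `n` in the parity. -/
theorem abs_sub_le_pathSum {e x : ℕ → ℝ} {n : ℕ} (h : ∀ i < n, Frechet (e i) (e (i + 1)) (x i))
    (a : ℕ → ZMod 2) :
    |e 0 - sgn (∑ i ∈ Finset.range n, a i + n) * e n| ≤ pathSum x n a := by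
  induction n with
  | zero => simp [pathSum]
  | succ n ih =>
    have h1 := ih fun i hi ↦ h i (by omega)
    have h2 := (h n (by omega)).abs_add_sgn_mul_le (a n)
    rw [pathSum_succ]
    set s : ZMod 2 := ∑ i ∈ Finset.range n, a i + n with hs
    have h3 : sgn (∑ i ∈ Finset.range (n + 1), a i + (n + 1 : ℕ)) = -(sgn s * sgn (a n)) := by
      rw [← sgn_add, ← sgn_add_one, hs, Finset.sum_range_succ]
      congr 1
      push_cast
      ring
    have h4 : |sgn s * (e n + sgn (a n) * e (n + 1))| = |e n + sgn (a n) * e (n + 1)| := by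
      rw [abs_mul, abs_sgn, one_mul]
    rw [h3]
    calc _ = |(e 0 - sgn s * e n) + sgn s * (e n + sgn (a n) * e (n + 1))| := by ring_nf
      _ ≤ _ := (abs_add_le _ _).trans (by linarith)

theorem abs_sub_le_pathSum_of_sum_eq {e x : ℕ → ℝ} {n : ℕ}
    (h : ∀ i < n, Frechet (e i) (e (i + 1)) (x i)) {a : ℕ → ZMod 2}
    (ha : ∑ i ∈ Finset.range n, a i = n) : |e 0 - e n| ≤ pathSum x n a := by
  have := abs_sub_le_pathSum h a
  rwa [ha, CharTwo.add_self_eq_zero, sgn_zero, one_mul] at this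

theorem abs_add_le_pathSum_of_sum_eq {e x : ℕ → ℝ} {n : ℕ}
    (h : ∀ i < n, Frechet (e i) (e (i + 1)) (x i)) {a : ℕ → ZMod 2}
    (ha : ∑ i ∈ Finset.range n, a i = n + 1) : |e 0 + e n| ≤ pathSum x n a := by
  have := abs_sub_le_pathSum h a
  rwa [ha, add_right_comm, CharTwo.add_self_eq_zero, zero_add, sgn_one, neg_one_mul,
    sub_neg_eq_add] at this

/-- The circle inequalities for the circle that consists of a line with `n` edges of expectation
values `x i` and an edge of expectation value `t` joining its end points. -/
def ClosesUp (x : ℕ → ℝ) (n : ℕ) (t : ℝ) : Prop :=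
  ∀ (a : ℕ → ZMod 2), (∑ i ∈ Finset.range n, a i = n → 1 - pathSum x n a ≤ t) ∧
    (∑ i ∈ Finset.range n, a i = n + 1 → t ≤ pathSum x n a - 1)

theorem ClosesUp.one_le {x : ℕ → ℝ} {n : ℕ} {t : ℝ} (h : ClosesUp x n t) {a : ℕ → ZMod 2}
    (b : ZMod 2) (ha : ∑ i ∈ Finset.range n, a i = n + b) : 1 ≤ pathSum x n a + sgn b * t := by
  rcases zmod_two_cases b with rfl | rfl
  · have := (h a).1 (by simpa using ha)
    simp; linarith
  · have := (h a).2 ha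
    simp; linarith

/-- The diagonal from `0` to `n` cuts the circle into a circle with one edge fewer on its line and a
triangle with sides `x n`, `t`, `r`. There are three kinds of lower and of upper bounds on `r`, and
every pair is compatible. -/
theorem ClosesUp.exists_diagonal {e x : ℕ → ℝ} {n : ℕ} {t : ℝ}
    (hx : ∀ i < n + 1, Frechet (e i) (e (i + 1)) (x i)) (ht : Frechet (e 0) (e (n + 1)) t)
    (h : ClosesUp x (n + 1) t) :
    ∃ r, Frechet (e 0) (e n) r ∧ Frechet (x n) t r ∧ ClosesUp x n r := by
  have hx' : ∀ i < n, Frechet (e i) (e (i + 1)) (x i) := fun i hi ↦ hx i (by omega)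
  have hxn := hx n (by omega)
  -- The inequality of the long circle, with label `b` on the edge `n` and `c` on the closing edge.
  have key (a : ℕ → ZMod 2) (b c : ZMod 2)
      (hab : ∑ i ∈ Finset.range n, a i + b = (n + 1 : ℕ) + c) :
      1 ≤ pathSum x n a + (1 + sgn b * x n) + sgn c * t := by
    have := h.one_le (a := fun i ↦ if i < n then a i else b) c (by
      rw [Finset.sum_range_succ, ← hab, if_neg (lt_irrefl n)]
      congr 1
      exact Finset.sum_congr rfl fun i hi ↦ if_pos (Finset.mem_range.1 hi))
    rw [pathSum_succ, if_neg (lt_irrefl n)] at this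
    rwa [pathSum_congr (a' := a) fun i hi ↦ if_pos hi] at this
  have e2 : (1 + 1 : ZMod 2) = 0 := rfl
  obtain ⟨r, hl, hu⟩ := exists_between_of_forall_le
    (s := {l | l = |e 0 + e n| - 1 ∨ l = |x n + t| - 1 ∨
      ∃ a : ℕ → ZMod 2, ∑ i ∈ Finset.range n, a i = n ∧ l = 1 - pathSum x n a})
    (t := {u | u = 1 - |e 0 - e n| ∨ u = 1 - |x n - t| ∨
      ∃ a : ℕ → ZMod 2, ∑ i ∈ Finset.range n, a i = n + 1 ∧ u = pathSum x n a - 1})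
    ⟨_, Or.inl rfl⟩ ⟨_, Or.inl rfl⟩ (by
      have he0 := ht.abs_left_le
      have hen := hxn.abs_left_le
      have hxn1 := hxn.abs_corr_le
      have ht1 := ht.abs_corr_le
      rintro _ (rfl | rfl | ⟨a, ha, rfl⟩) _ (rfl | rfl | ⟨a', ha', rfl⟩)
      · suffices |e 0 + e n| + |e 0 - e n| ≤ 2 by linarith
        rw [abs_le] at he0 hen
        rcases abs_cases (e 0 + e n) with h | h <;> rcases abs_cases (e 0 - e n) with h' | h' <;>
          linarith
      · obtain ⟨h1, h2⟩ := hxn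
        obtain ⟨h3, h4⟩ := ht
        -- The mean `e (n + 1)` is eliminated between the Fréchet bounds of the edge `n` and of the
        -- closing edge.
        suffices |e 0 + e n| + |x n - t| ≤ 2 by linarith
        rw [abs_le] at h1 h2 h3 h4
        rcases abs_cases (e 0 + e n) with h | h <;> rcases abs_cases (x n - t) with h' | h' <;>
          linarith
      · linarith [abs_add_le_pathSum_of_sum_eq hx' ha']
      · obtain ⟨h1, h2⟩ := hxn
        obtain ⟨h3, h4⟩ := ht
        suffices |x n + t| + |e 0 - e n| ≤ 2 by linarith
        rw [abs_le] at h1 h2 h3 h4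
        rcases abs_cases (x n + t) with h | h <;> rcases abs_cases (e 0 - e n) with h' | h' <;>
          linarith
      · suffices |x n + t| + |x n - t| ≤ 2 by linarith
        rw [abs_le] at hxn1 ht1
        rcases abs_cases (x n + t) with h | h <;> rcases abs_cases (x n - t) with h' | h' <;>
          linarith
      · have h1 := key a' 0 0 (by rw [ha']; push_cast; ring)
        have h2 := key a' 1 1 (by rw [ha']; push_cast; ring)
        simp at h1 h2
        rcases abs_cases (x n + t) with h | h <;> linarith
      · linarith [abs_sub_le_pathSum_of_sum_eq hx' ha]
      · have h1 := key a 1 0 (by rw [ha]; push_cast; ring)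
        have h2 := key a 0 1 (by rw [ha]; push_cast; linear_combination -e2)
        simp at h1 h2
        rcases abs_cases (x n - t) with h | h <;> linarith
      · have := two_le_pathSum_add_pathSum (x := x) (n := n) (a := a) (a' := a')
          (fun i hi ↦ (hx' i hi).abs_corr_le) (by rw [ha, ha']; simp)
        linarith)
  refine ⟨r, ⟨?_, ?_⟩, ⟨?_, ?_⟩, fun a ↦ ⟨fun ha ↦ ?_, fun ha ↦ ?_⟩⟩
  · linarith [hl (Or.inl rfl)]
  · linarith [hu (Or.inl rfl)]
  · linarith [hl (Or.inr (Or.inl rfl))]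
  · linarith [hu (Or.inr (Or.inl rfl))]
  · exact hl (Or.inr (Or.inr ⟨a, ha, rfl⟩))
  · exact hu (Or.inr (Or.inr ⟨a, ha, rfl⟩))

/-- A line with prescribed expectation values at its vertices and edges has a joint distribution
such that its end points have correlation `t`, provided the circle closed up by `t` satisfies the
circle inequalities. -/
theorem ClosesUp.exists_dist {e x : ℕ → ℝ} {n : ℕ} (hn : n ≠ 0) {t : ℝ}
    (hx : ∀ i < n, Frechet (e i) (e (i + 1)) (x i)) (ht : Frechet (e 0) (e n) t)
    (h : ClosesUp x n t) :
    ∃ D : Dist (ℕ → ZMod 2), HasMoments D (fun s ↦ s 0) (fun s ↦ s n) (e 0) (e n) t ∧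
      ∀ i < n, HasMoments D (fun s ↦ s i) (fun s ↦ s (i + 1)) (e i) (e (i + 1)) (x i) := by
  induction n, Nat.one_le_iff_ne_zero.2 hn using Nat.le_induction generalizing t with
  | base =>
    -- For a single edge the two labels give opposite inequalities, so the chord must carry the
    -- correlation of the edge.
    obtain rfl : t = x 0 := by
      refine le_antisymm ?_ ?_
      · have := h.one_le (a := fun _ ↦ 0) 1 (by simp; rfl)
        simp [pathSum] at this
        linarith
      · have := h.one_le (a := fun _ ↦ 1) 0 (by simp)
        simp [pathSum] at this
        linarith
    obtain ⟨R, hR⟩ := exists_pair ht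
    have hD := (hasMoments_map (p := R) (φ := fun y (i : ℕ) ↦ if i = 0 then y.1 else y.2)
      (f := fun s ↦ s 0) (g := fun s ↦ s 1)).2 (by simpa using hR)
    exact ⟨_, hD, fun i hi ↦ by obtain rfl : i = 0 := by omega
                                exact hD⟩
  | succ n hn' ih =>
    obtain ⟨r, hr1, hr2, hr3⟩ := h.exists_diagonal hx ht
    obtain ⟨D, hD1, hD2⟩ := ih (by omega) (fun i hi ↦ hx i (by omega)) hr1 hr3
    -- The coordinates of `T` are the vertices `0`, `n`, `n + 1`. `D` and `T` have the same moments
    -- on the diagonal, hence the same law there, and can be amalgamated.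
    obtain ⟨T, hT1, hT2, hT3⟩ := exists_triple hr1 (hx n (by omega)) ht hr2
    obtain ⟨A, hA1, hA2, hA3⟩ := exists_amalgam D T _ _ (hD1.map_eq hT1)
    simp only [Prod.mk.injEq] at hA3
    subst hA1 hA2
    refine ⟨A.map fun y i ↦ if i = n + 1 then y.2.2.2 else y.1 i, ?_, fun i hi ↦ ?_⟩
    · rw [hasMoments_map]
      refine (hasMoments_map.1 hT3).congr (fun y hy ↦ ?_) (fun y hy ↦ by simp)
      simp [(hA3 y hy).1]
    · rw [hasMoments_map]
      rcases Nat.lt_succ_iff_lt_or_eq.1 hi with hi | rfl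
      · refine (hasMoments_map.1 (hD2 i hi)).congr (fun y hy ↦ ?_) (fun y hy ↦ ?_)
        · exact (if_neg (by omega)).symm
        · exact (if_neg (by omega)).symm
      · refine (hasMoments_map.1 hT2).congr (fun y hy ↦ ?_) (fun y hy ↦ by simp)
        simp [(hA3 y hy).2]

/-! ### Gluing the petals of a flower -/

/-- The point at position `j` of the line `L_{N_i}`, for `j ≤ N_i`. -/
def petalPoint {k : ℕ} (N : Fin k → ℕ) (i : Fin k) (j : ℕ) : FlowerVertex N :=
  if h0 : j = 0 then .v else if h1 : j < N i then .inner i j ⟨Nat.pos_of_ne_zero h0, h1⟩ else .w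

theorem linePoint_eq_petalPoint {k : ℕ} (N : Fin k → ℕ) (i : Fin k) (j : Fin (N i + 1)) :
    linePoint N i j = petalPoint N i j := by
  have := j.2
  unfold linePoint petalPoint
  by_cases h0 : (j : ℕ) = 0
  · rw [dif_pos h0, dif_pos h0]
  · rw [dif_neg h0, dif_neg h0]
    by_cases h1 : (j : ℕ) = N i
    · rw [dif_pos h1, dif_neg (by omega)]
    · rw [dif_neg h1, dif_pos (by omega)]

@[simp] theorem petalPoint_zero {k : ℕ} (N : Fin k → ℕ) (i : Fin k) : petalPoint N i 0 = .v := rfl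

theorem petalPoint_last {k : ℕ} {N : Fin k → ℕ} {i : Fin k} (h : N i ≠ 0) :
    petalPoint N i (N i) = .w := by
  simp [petalPoint, h]

/-- Replace the values of `s` at the interior points of the petal `i` by those of `u`. -/
def replacePetal {k : ℕ} {N : Fin k → ℕ} (i : Fin k) (s : FlowerVertex N → ZMod 2)
    (u : ℕ → ZMod 2) : FlowerVertex N → ZMod 2
  | .v => s .v
  | .w => s .w
  | .inner i' j hj => if i' = i then u j else s (.inner i' j hj)

theorem replacePetal_of_ne {k : ℕ} {N : Fin k → ℕ} {i i' : Fin k} (h : i' ≠ i)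
    (s : FlowerVertex N → ZMod 2) (u : ℕ → ZMod 2) (j : ℕ) :
    replacePetal i s u (petalPoint N i' j) = s (petalPoint N i' j) := by
  unfold petalPoint
  split_ifs <;> simp [replacePetal, h]

theorem replacePetal_self {k : ℕ} {N : Fin k → ℕ} {i : Fin k} {s : FlowerVertex N → ZMod 2}
    {u : ℕ → ZMod 2} (hv : s .v = u 0) (hw : s .w = u (N i)) {j : ℕ} (hj : j ≤ N i) :
    replacePetal i s u (petalPoint N i j) = u j := by
  unfold petalPoint
  split_ifs with h0 h1
  · subst h0
    exact hv
  · simp [replacePetal]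
  · obtain rfl : j = N i := by omega
    exact hw

/-- The circle inequalities for pairs of petals give a correlation of the two common end points
which is compatible with every petal. -/
theorem exists_common_diagonal {k : ℕ} (hk : 1 ≤ k) {N : Fin k → ℕ} (hN : ∀ i, 1 ≤ N i)
    {m : FlowerVertex N → ℝ} {x : Fin k → ℕ → ℝ}
    (hx : ∀ i, ∀ j < N i, Frechet (m (petalPoint N i j)) (m (petalPoint N i (j + 1))) (x i j))
    (hc : ∀ i i', i ≠ i' → ∀ a a' : ℕ → ZMod 2, ∑ j ∈ Finset.range (N i), a j = N i →
      ∑ j ∈ Finset.range (N i'), a' j = N i' + 1 →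
      2 ≤ pathSum (x i) (N i) a + pathSum (x i') (N i') a') :
    ∃ t, Frechet (m .v) (m .w) t ∧ ∀ i, ClosesUp (x i) (N i) t := by
  have hsub (i : Fin k) (a : ℕ → ZMod 2) (ha : ∑ j ∈ Finset.range (N i), a j = N i) :
      |m .v - m .w| ≤ pathSum (x i) (N i) a := by
    have := abs_sub_le_pathSum_of_sum_eq (e := fun j ↦ m (petalPoint N i j)) (hx i) ha
    rwa [petalPoint_last (by have := hN i; omega)] at this
  have hadd (i : Fin k) (a : ℕ → ZMod 2) (ha : ∑ j ∈ Finset.range (N i), a j = N i + 1) :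
      |m .v + m .w| ≤ pathSum (x i) (N i) a := by
    have := abs_add_le_pathSum_of_sum_eq (e := fun j ↦ m (petalPoint N i j)) (hx i) ha
    rwa [petalPoint_last (by have := hN i; omega)] at this
  have hv : |m .v| ≤ 1 := (hx ⟨0, hk⟩ 0 (hN _)).abs_left_le
  have hw : |m .w| ≤ 1 := by
    have h1 := hN ⟨0, hk⟩
    have := (hx ⟨0, hk⟩ (N ⟨0, hk⟩ - 1) (by omega)).symm.abs_left_le
    rwa [Nat.sub_add_cancel h1, petalPoint_last (by omega)] at this
  obtain ⟨t, hl, hu⟩ := exists_between_of_forall_le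
    (s := {l | l = |m .v + m .w| - 1 ∨ ∃ (i : Fin k) (a : ℕ → ZMod 2),
      ∑ j ∈ Finset.range (N i), a j = N i ∧ l = 1 - pathSum (x i) (N i) a})
    (t := {u | u = 1 - |m .v - m .w| ∨ ∃ (i : Fin k) (a : ℕ → ZMod 2),
      ∑ j ∈ Finset.range (N i), a j = N i + 1 ∧ u = pathSum (x i) (N i) a - 1})
    ⟨_, Or.inl rfl⟩ ⟨_, Or.inl rfl⟩ (by
      rintro _ (rfl | ⟨i, a, ha, rfl⟩) _ (rfl | ⟨i', a', ha', rfl⟩)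
      · suffices |m .v + m .w| + |m .v - m .w| ≤ 2 by linarith
        rw [abs_le] at hv hw
        rcases abs_cases (m .v + m .w) with h | h <;> rcases abs_cases (m .v - m .w) with h' | h' <;>
          linarith
      · linarith [hadd i' a' ha']
      · linarith [hsub i a ha]
      · suffices 2 ≤ pathSum (x i) (N i) a + pathSum (x i') (N i') a' by linarith
        -- Only for two distinct petals are the circle inequalities needed.
        rcases eq_or_ne i i' with rfl | hne
        · exact two_le_pathSum_add_pathSum (fun j hj ↦ (hx i j hj).abs_corr_le)
            (by rw [ha, ha']; simp)
        · exact hc i i' hne a a' ha ha')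
  refine ⟨t, ⟨?_, ?_⟩, fun i a ↦ ⟨fun ha ↦ ?_, fun ha ↦ ?_⟩⟩
  · linarith [hl (Or.inl rfl)]
  · linarith [hu (Or.inl rfl)]
  · exact hl (Or.inr ⟨i, a, ha, rfl⟩)
  · exact hu (Or.inr ⟨i, a, ha, rfl⟩)

/-- A family of expectation values at the vertices and edges of a flower which satisfies the
Fréchet bounds and the circle inequalities comes from a joint distribution. -/
theorem exists_flower_dist {k : ℕ} (hk : 1 ≤ k) {N : Fin k → ℕ} (hN : ∀ i, 1 ≤ N i)
    {m : FlowerVertex N → ℝ} {x : Fin k → ℕ → ℝ}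
    (hx : ∀ i, ∀ j < N i, Frechet (m (petalPoint N i j)) (m (petalPoint N i (j + 1))) (x i j))
    (hc : ∀ i i', i ≠ i' → ∀ a a' : ℕ → ZMod 2, ∑ j ∈ Finset.range (N i), a j = N i →
      ∑ j ∈ Finset.range (N i'), a' j = N i' + 1 →
      2 ≤ pathSum (x i) (N i) a + pathSum (x i') (N i') a') :
    ∃ D : Dist (FlowerVertex N → ZMod 2), ∀ i, ∀ j < N i,
      HasMoments D (fun s ↦ s (petalPoint N i j)) (fun s ↦ s (petalPoint N i (j + 1)))
        (m (petalPoint N i j)) (m (petalPoint N i (j + 1))) (x i j) := by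
  obtain ⟨t, ht, htc⟩ := exists_common_diagonal hk hN hx hc
  have hlast (i : Fin k) : petalPoint N i (N i) = .w := petalPoint_last (by have := hN i; omega)
  have hpetal (i : Fin k) := (htc i).exists_dist (e := fun j ↦ m (petalPoint N i j))
    (by have := hN i; omega) (hx i) (by simpa only [petalPoint_zero, hlast] using ht)
  -- Petals are glued one at a time. The moments of the pair `(v, w)` are carried along, so that the
  -- law on the common end points agrees with that of the next petal.
  suffices H : ∀ S : Finset (Fin k), ∃ D : Dist (FlowerVertex N → ZMod 2),
      HasMoments D (fun s ↦ s .v) (fun s ↦ s .w) (m .v) (m .w) t ∧ ∀ i ∈ S, ∀ j < N i,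
        HasMoments D (fun s ↦ s (petalPoint N i j)) (fun s ↦ s (petalPoint N i (j + 1)))
          (m (petalPoint N i j)) (m (petalPoint N i (j + 1))) (x i j) by
    obtain ⟨D, -, hD⟩ := H Finset.univ
    exact ⟨D, fun i ↦ hD i (Finset.mem_univ i)⟩
  intro S
  induction S using Finset.induction_on with
  | empty =>
    classical
    obtain ⟨R, hR⟩ := exists_pair ht
    refine ⟨R.map fun y z ↦ if z = .v then y.1 else y.2, ?_, by simp⟩
    rw [hasMoments_map]
    simpa using hR
  | insert i S hi ih =>
    obtain ⟨D, hD1, hD2⟩ := ih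
    obtain ⟨T, hT1, hT2⟩ := hpetal i
    simp only [petalPoint_zero, hlast] at hT1
    obtain ⟨A, hA1, hA2, hA3⟩ := exists_amalgam D T _ _ (hD1.map_eq hT1)
    simp only [Prod.mk.injEq] at hA3
    subst hA1 hA2
    refine ⟨A.map fun y ↦ replacePetal i y.1 y.2, ?_, fun i' hi' j hj ↦ ?_⟩
    · rw [hasMoments_map]
      exact hasMoments_map.1 hD1
    · rw [hasMoments_map]
      rcases eq_or_ne i' i with rfl | hne
      · refine (hasMoments_map.1 (hT2 j hj)).congr (fun y hy ↦ ?_) (fun y hy ↦ ?_)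
        · exact (replacePetal_self (hA3 y hy).1 (hA3 y hy).2 hj.le).symm
        · exact (replacePetal_self (hA3 y hy).1 (hA3 y hy).2 hj).symm
      · refine (hasMoments_map.1 (hD2 i' (Finset.mem_of_mem_insert_of_ne hi' hne) j hj)).congr
          (fun y hy ↦ ?_) (fun y hy ↦ ?_)
        · exact (replacePetal_of_ne hne _ _ _).symm
        · exact (replacePetal_of_ne hne _ _ _).symm

/-! ### Simplices of the nerve of `ℤ₂` -/

/-- The group element on the edge of a simplex of `N ℤ₂` from vertex `i` to vertex `j`. -/
def arrowValue {n : SimplexCategoryᵒᵖ} (y : NZ2.obj n) {i j : Fin (n.unop.len + 1)}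
    (h : i ≤ j) : ZMod 2 :=
  Multiplicative.toAdd (α := ZMod 2)
    (CategoryTheory.Functor.map (C := Fin (n.unop.len + 1)) (D := SingleObj (Multiplicative (ZMod 2))) y
      (homOfLE h))

theorem arrowValue_trans {n : SimplexCategoryᵒᵖ} (y : NZ2.obj n) {i j k : Fin (n.unop.len + 1)}
    (h : i ≤ j) (h' : j ≤ k) :
    arrowValue y (h.trans h') = arrowValue y h + arrowValue y h' := by
  refine Eq.trans ?_ (add_comm _ _)
  exact congrArg (Multiplicative.toAdd (α := ZMod 2))
    (CategoryTheory.Functor.map_comp (C := Fin (n.unop.len + 1)) (D := SingleObj (Multiplicative (ZMod 2))) y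
      (homOfLE h) (homOfLE h'))

/-- By additivity, the value on an edge from `i` to `j` is the difference of the values on the edges
from `0`. -/
theorem arrowValue_ext {n : SimplexCategoryᵒᵖ} {y y' : NZ2.obj n}
    (h : ∀ j, arrowValue y (Fin.zero_le j) = arrowValue y' (Fin.zero_le j)) : y = y' := by
  have h' {i j : Fin (n.unop.len + 1)} (hij : i ≤ j) : arrowValue y hij = arrowValue y' hij := by
    have h1 := arrowValue_trans y (Fin.zero_le i) hij
    have h2 := arrowValue_trans y' (Fin.zero_le i) hij
    have h3 := h j
    have h4 := h i
    rw [h1, h2, h4] at h3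
    exact add_left_cancel h3
  exact CategoryTheory.Functor.ext (C := Fin (n.unop.len + 1)) (D := SingleObj (Multiplicative (ZMod 2)))
    (fun _ ↦ rfl) (fun i j f ↦ by
      have := h' (leOfHom f)
      simp
      exact congrArg Multiplicative.ofAdd this)

/-- The `i`-th vertex of a simplex. -/
def vertexAt {Y : SSet.{0}} {n : SimplexCategoryᵒᵖ} (y : Y.obj n) (i : Fin (n.unop.len + 1)) :
    Y.obj (op (.mk 0)) :=
  Y.map (SimplexCategory.const (.mk 0) n.unop i).op y

theorem vertexAt_map {Y : SSet.{0}} {m n : SimplexCategoryᵒᵖ} (θ : m ⟶ n) (y : Y.obj m)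
    (i : Fin (n.unop.len + 1)) : vertexAt (Y.map θ y) i = vertexAt y (θ.unop.toOrderHom i) := by
  unfold vertexAt
  rw [← comp_apply, ← CategoryTheory.Functor.map_comp]
  rfl

/-- The simplicial map to `N ℤ₂` given by the coboundary of a function on vertices. -/
def coboundary {Y : SSet.{0}} (s : Y.obj (op (.mk 0)) → ZMod 2) : Y ⟶ NZ2 where
  app n := ↾fun y ↦ (show Fin (n.unop.len + 1) ⥤ SingleObj (Multiplicative (ZMod 2)) from
    { obj := fun _ ↦ SingleObj.star _
      map := fun {i j} _ ↦ Multiplicative.ofAdd (s (vertexAt y j) - s (vertexAt y i))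
      map_id := fun i ↦ congrArg Multiplicative.ofAdd (sub_self _)
      map_comp := fun {i j k} _ _ ↦ congrArg Multiplicative.ofAdd
        (sub_add_sub_cancel _ _ _).symm })
  naturality m n θ := by
    ext y
    refine arrowValue_ext fun j ↦ ?_
    change s (vertexAt (Y.map θ y) j) - s (vertexAt (Y.map θ y) 0) =
      s (vertexAt y (θ.unop.toOrderHom j)) - s (vertexAt y (θ.unop.toOrderHom 0))
    rw [vertexAt_map, vertexAt_map]

theorem arrowValue_coboundary {Y : SSet.{0}} (s : Y.obj (op (.mk 0)) → ZMod 2)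
    {n : SimplexCategoryᵒᵖ} (y : Y.obj n) {i j : Fin (n.unop.len + 1)} (h : i ≤ j) :
    arrowValue ((coboundary s).app n y) h = s (vertexAt y j) - s (vertexAt y i) :=
  rfl

/-- The value of a `1`-simplex of `N ℤ₂`. -/
def edgeValue (y : NZ2.obj (op (.mk 1))) : ZMod 2 := arrowValue y (Fin.zero_le 1)

/-- The values of a `2`-simplex of `N ℤ₂` on its two edges with initial vertex `0`. -/
def triangleValue (y : NZ2.obj (op (.mk 2))) : ZMod 2 × ZMod 2 :=
  (arrowValue y (Fin.zero_le 1), arrowValue y (Fin.zero_le 2))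

theorem edgeValue_injective : Function.Injective edgeValue := fun y y' h ↦ by
  refine arrowValue_ext fun j ↦ ?_
  have h0 : arrowValue y (le_refl 0) = arrowValue y' (le_refl 0) := by
    -- The value on a degenerate edge equals its own double, hence is zero.
    have h1 := arrowValue_trans y (le_refl 0) (le_refl 0)
    have h2 := arrowValue_trans y' (le_refl 0) (le_refl 0)
    simp only [left_eq_add] at h1 h2
    rw [h1, h2]
  change Fin 2 at j
  fin_cases j
  exacts [h0, h]

theorem triangleValue_injective : Function.Injective triangleValue := fun y y' h ↦ by
  refine arrowValue_ext fun j ↦ ?_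
  have h0 : arrowValue y (le_refl 0) = arrowValue y' (le_refl 0) := by
    have h1 := arrowValue_trans y (le_refl 0) (le_refl 0)
    have h2 := arrowValue_trans y' (le_refl 0) (le_refl 0)
    simp only [left_eq_add] at h1 h2
    rw [h1, h2]
  change Fin 3 at j
  fin_cases j
  exacts [h0, congrArg Prod.fst h, congrArg Prod.snd h]

/-- The third face carries a difference, which is a sum modulo `2`. This is why the expectation of a
base edge is a correlation of cone edges. -/
theorem edgeValue_δ (y : NZ2.obj (op (.mk 2))) :
    edgeValue (NZ2.map (SimplexCategory.δ 2).op y) = (triangleValue y).1 ∧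
    edgeValue (NZ2.map (SimplexCategory.δ 1).op y) = (triangleValue y).2 ∧
    edgeValue (NZ2.map (SimplexCategory.δ 0).op y) = (triangleValue y).1 + (triangleValue y).2 := by
  refine ⟨rfl, rfl, ?_⟩
  have h : arrowValue y (Fin.zero_le (2 : Fin 3)) = arrowValue y (Fin.zero_le (1 : Fin 3)) +
    arrowValue y (show (1 : Fin 3) ≤ 2 by decide) := arrowValue_trans y _ _
  change arrowValue y (show (1 : Fin 3) ≤ 2 by decide) = arrowValue y (Fin.zero_le (1 : Fin 3)) +
    arrowValue y (Fin.zero_le (2 : Fin 3))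
  rw [h, ← add_assoc, CharTwo.add_self_eq_zero, zero_add]

theorem expectation_eq_mean {X : SSet.{0}} (p : SDist X NZ2) (τ : X.obj (op (.mk 1))) :
    expectation p τ = mean (U := NZ2.obj (op (.mk 1))) (p.app _ τ) (fun y ↦ sgn (edgeValue y)) := by
  set q : Dist (NZ2.obj (op (.mk 1))) := p.app _ τ with hq
  have h (a : ZMod 2) : prob p τ a = (q.map edgeValue).weights a :=
    (Finsupp.mapDomain_apply edgeValue_injective q.weights (outcome a)).symm
  have := mean_map q edgeValue sgn
  rw [← this, mean_eq_sum, sum_zmod_two, expectation, h, h]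
  simp [sub_eq_add_neg]

/-! ### Simplices of cones -/

/-- The edge from the cone point to a vertex. -/
def coneEdge {X : SSet.{0}} (v : X.obj (op (.mk 0))) : (cone X).obj (op (.mk 1)) :=
  ConeSimplex.part (n := 1) 1 0 rfl v

/-- The cone over an edge. -/
def coneTriangle {X : SSet.{0}} (σ : X.obj (op (.mk 1))) : (cone X).obj (op (.mk 2)) :=
  ConeSimplex.part (n := 2) 1 1 rfl σ

/-- The cone point is the vertex `0` of the triangle, so omitting the vertex `j + 1` omits the
vertex `j` of `σ`. -/
theorem coneTriangle_δ_two {X : SSet.{0}} (σ : X.obj (op (.mk 1))) :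
    (cone X).map (SimplexCategory.δ 2).op (coneTriangle σ) =
      coneEdge (X.map (SimplexCategory.δ 1).op σ) := by
  refine (ConeSimplex.map_part_of_le (m := .mk 1) (n := .mk 2) (SimplexCategory.δ 2) 1 1 rfl σ 1 0
    rfl (by decide)).trans ?_
  have h : tail (SimplexCategory.δ 2 : .mk 1 ⟶ .mk 2) 1 0 1 1 rfl rfl (by decide) =
      SimplexCategory.δ 1 := by
    ext i
    fin_cases i
    rfl
  rw [h]
  rfl

theorem coneTriangle_δ_one {X : SSet.{0}} (σ : X.obj (op (.mk 1))) :
    (cone X).map (SimplexCategory.δ 1).op (coneTriangle σ) =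
      coneEdge (X.map (SimplexCategory.δ 0).op σ) := by
  refine (ConeSimplex.map_part_of_le (m := .mk 1) (n := .mk 2) (SimplexCategory.δ 1) 1 1 rfl σ 1 0
    rfl (by decide)).trans ?_
  have h : tail (SimplexCategory.δ 1 : .mk 1 ⟶ .mk 2) 1 0 1 1 rfl rfl (by decide) =
      SimplexCategory.δ 0 := by
    ext i
    fin_cases i
    rfl
  rw [h]
  rfl

theorem coneTriangle_δ_zero {X : SSet.{0}} (σ : X.obj (op (.mk 1))) :
    (cone X).map (SimplexCategory.δ 0).op (coneTriangle σ) = (coneIncl X).app _ σ := by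
  refine (ConeSimplex.map_part_of_le (m := .mk 1) (n := .mk 2) (SimplexCategory.δ 0) 1 1 rfl σ 0 1
    rfl (by decide)).trans ?_
  have h : tail (SimplexCategory.δ 0 : .mk 1 ⟶ .mk 2) 0 1 1 1 rfl rfl (by decide) =
      𝟙 _ := by
    ext i
    fin_cases i <;> rfl
  rw [h, op_id, CategoryTheory.Functor.map_id]
  rfl

/-! ### Simplicial distributions on cones -/

theorem edgeValue_coneIncl {X : SSet.{0}} (s : cone X ⟶ NZ2) (σ : X.obj (op (.mk 1))) :
    edgeValue (s.app _ ((coneIncl X).app _ σ)) =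
      edgeValue (s.app _ (coneEdge (X.map (SimplexCategory.δ 1).op σ))) +
      edgeValue (s.app _ (coneEdge (X.map (SimplexCategory.δ 0).op σ))) := by
  rw [← coneTriangle_δ_zero, ← coneTriangle_δ_one, ← coneTriangle_δ_two, NatTrans.naturality_apply,
    NatTrans.naturality_apply, NatTrans.naturality_apply, (edgeValue_δ _).1, (edgeValue_δ _).2.1,
    (edgeValue_δ _).2.2]

theorem triangleValue_coneTriangle {X : SSet.{0}} (s : cone X ⟶ NZ2) (σ : X.obj (op (.mk 1))) :
    triangleValue (s.app _ (coneTriangle σ)) =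
      (edgeValue (s.app _ (coneEdge (X.map (SimplexCategory.δ 1).op σ))),
        edgeValue (s.app _ (coneEdge (X.map (SimplexCategory.δ 0).op σ)))) := by
  rw [← coneTriangle_δ_one, ← coneTriangle_δ_two, NatTrans.naturality_apply,
    NatTrans.naturality_apply, (edgeValue_δ _).1, (edgeValue_δ _).2.1]

theorem expectation_map {X : SSet.{0}} (p : SDist X NZ2) {n : SimplexCategoryᵒᵖ}
    (θ : n ⟶ op (.mk 1)) (τ : X.obj n) :
    expectation p (X.map θ τ) =
      mean (U := NZ2.obj n) (p.app _ τ) (fun y ↦ sgn (edgeValue (NZ2.map θ y))) := by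
  rw [expectation_eq_mean, NatTrans.naturality_apply]
  exact mean_map (U := NZ2.obj n) (p.app _ τ) (NZ2.map θ) _

theorem hasMoments_coneTriangle {X : SSet.{0}} (p : SDist (cone X) NZ2) (σ : X.obj (op (.mk 1))) :
    HasMoments (U := NZ2.obj (op (.mk 2))) (p.app _ (coneTriangle σ))
      (fun y ↦ (triangleValue y).1) (fun y ↦ (triangleValue y).2)
      (expectation p (coneEdge (X.map (SimplexCategory.δ 1).op σ)))
      (expectation p (coneEdge (X.map (SimplexCategory.δ 0).op σ)))
      (expectation p ((coneIncl X).app _ σ)) := by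
  rw [← coneTriangle_δ_zero, ← coneTriangle_δ_one, ← coneTriangle_δ_two, expectation_map,
    expectation_map, expectation_map]
  simp only [(edgeValue_δ _).1, (edgeValue_δ _).2.1, (edgeValue_δ _).2.2]
  exact ⟨rfl, rfl, rfl⟩

theorem expectation_theta {X : SSet.{0}} (d : Dist (X ⟶ NZ2)) (τ : X.obj (op (.mk 1))) :
    expectation (theta d) τ = mean d (fun s ↦ sgn (edgeValue (s.app _ τ))) := by
  rw [expectation_eq_mean]
  exact mean_map d (fun s ↦ s.app _ τ) _

/-! ### Cones over graphs: outcome assignments and generating triangles -/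

/-- The assignment of outcomes on a cone over a graph given by a function on its vertices. -/
def coneAssignment {G : MultiDigraph} (s : G.Vertex → ZMod 2) : cone (graphSpace G) ⟶ NZ2 :=
  coboundary fun
    | .apex => 0
    | .part _ _ _ (GraphSimplex.vertex v) => s v
    -- This value is irrelevant: in dimension `0` there is no surjection onto `Fin 2`.
    | .part _ _ _ (GraphSimplex.edge _ _ _) => 0

/-- A vertex of `graphSpace G`. -/
def genVertex {G : MultiDigraph} (v : G.Vertex) : (graphSpace G).obj (op (.mk 0)) :=
  GraphSimplex.vertex v

theorem edgeValue_coneAssignment {G : MultiDigraph} (s : G.Vertex → ZMod 2) (v : G.Vertex) :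
    edgeValue ((coneAssignment s).app _ (coneEdge (genVertex v))) = s v := by
  have h0 : vertexAt (coneEdge (genVertex v)) (0 : Fin 2) =
      (ConeSimplex.apex : ConeSimplex (graphSpace G) 0) :=
    ConeSimplex.map_part_of_forall_lt (m := .mk 0) (n := .mk 1) (SimplexCategory.const _ _ 0) 1 0
      rfl (genVertex v) (fun _ ↦ Nat.zero_lt_one)
  have h1 : vertexAt (coneEdge (genVertex v)) (1 : Fin 2) =
      (ConeSimplex.part 0 0 rfl (genVertex v) : ConeSimplex (graphSpace G) 0) :=
    ConeSimplex.map_part_of_le (m := .mk 0) (n := .mk 1) (SimplexCategory.const _ _ 1) 1 0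
      rfl (genVertex v) 0 0 rfl (fun _ ↦ by simp)
  refine (arrowValue_coboundary _ _ _).trans ?_
  erw [h0, h1]
  exact sub_zero _

theorem pullEdge_of_surjective {G : MultiDigraph} {n : ℕ} (e : G.Edge) {χ : Fin (n + 1) →o Fin 2}
    (hχ : Function.Surjective χ) : GraphSimplex.pullEdge e χ = .edge e χ hχ :=
  dif_pos hχ

theorem pullEdge_of_forall_eq_zero {G : MultiDigraph} {n : ℕ} (e : G.Edge)
    {χ : Fin (n + 1) →o Fin 2} (hχ : ∀ i, χ i = 0) :
    GraphSimplex.pullEdge e χ = .vertex (G.src e) := by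
  have h : ¬ Function.Surjective χ := fun h ↦ by
    obtain ⟨i, hi⟩ := h 1
    simp [hχ i] at hi
  rw [GraphSimplex.pullEdge, dif_neg h, if_pos (hχ 0)]

theorem pullEdge_of_forall_eq_one {G : MultiDigraph} {n : ℕ} (e : G.Edge)
    {χ : Fin (n + 1) →o Fin 2} (hχ : ∀ i, χ i = 1) :
    GraphSimplex.pullEdge e χ = .vertex (G.tgt e) := by
  have h : ¬ Function.Surjective χ := fun h ↦ by
    obtain ⟨i, hi⟩ := h 0
    simp [hχ i] at hi
  rw [GraphSimplex.pullEdge, dif_neg h, if_neg (by simp [hχ 0])]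

theorem genEdge_δ_one {G : MultiDigraph} (e : G.Edge) :
    (graphSpace G).map (SimplexCategory.δ 1).op (genEdge e) = genVertex (G.src e) :=
  pullEdge_of_forall_eq_zero (n := 0) e
    (χ := OrderHom.id.comp (SimplexCategory.δ (n := 0) 1).toOrderHom) fun i ↦ by fin_cases i; rfl

theorem genEdge_δ_zero {G : MultiDigraph} (e : G.Edge) :
    (graphSpace G).map (SimplexCategory.δ 0).op (genEdge e) = genVertex (G.tgt e) :=
  pullEdge_of_forall_eq_one (n := 0) e
    (χ := OrderHom.id.comp (SimplexCategory.δ (n := 0) 0).toOrderHom) fun i ↦ by fin_cases i; rfl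

theorem hasMoments_coneTriangle_genEdge {G : MultiDigraph} (p : SDist (cone (graphSpace G)) NZ2)
    (e : G.Edge) :
    HasMoments (U := NZ2.obj (op (.mk 2))) (p.app _ (coneTriangle (genEdge e)))
      (fun y ↦ (triangleValue y).1) (fun y ↦ (triangleValue y).2)
      (expectation p (coneEdge (genVertex (G.src e))))
      (expectation p (coneEdge (genVertex (G.tgt e))))
      (expectation p ((coneIncl _).app _ (genEdge e))) := by
  rw [← genEdge_δ_one, ← genEdge_δ_zero]
  exact hasMoments_coneTriangle p (genEdge e)

/-- A degenerate simplex on a vertex is the pull-back, along a constant map, of any edge with that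
end point. -/
theorem exists_pullEdge_eq {G : MultiDigraph} (hG : ∀ v, ∃ e, G.src e = v ∨ G.tgt e = v) {n : ℕ}
    (σ : GraphSimplex G n) : ∃ e χ, σ = GraphSimplex.pullEdge e χ := by
  cases σ with
  | edge e χ hχ => exact ⟨e, χ, (pullEdge_of_surjective e hχ).symm⟩
  | vertex v =>
    obtain ⟨e, rfl | rfl⟩ := hG v
    · exact ⟨e, ⟨fun _ ↦ 0, fun _ _ _ ↦ le_rfl⟩, (pullEdge_of_forall_eq_zero e fun _ ↦ rfl).symm⟩
    · exact ⟨e, ⟨fun _ ↦ 1, fun _ _ _ ↦ le_rfl⟩, (pullEdge_of_forall_eq_one e fun _ ↦ rfl).symm⟩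

/-- The monotone map `[n] → [2]` which is `0` on the first `b` vertices and `1 + χ` on the
others. -/
def consZero {n b l : ℕ} (h : b + l = n) (χ : Fin (l + 1) →o Fin 2) :
    SimplexCategory.mk n ⟶ SimplexCategory.mk 2 :=
  SimplexCategory.Hom.mk
    { toFun i := if hi : (i : ℕ) < b then (0 : Fin 3) else
        (χ ⟨i - b, by have := i.2; simp at this; omega⟩).succ
      monotone' i j hij := by
        have hij' : (i : ℕ) ≤ j := hij
        dsimp only
        split_ifs with h1 h2
        · exact le_rfl
        · exact Fin.zero_le _
        · omega
        · refine Fin.succ_le_succ_iff.2 (χ.monotone (Fin.le_def.2 ?_))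
          exact Nat.sub_le_sub_right hij' b }

/-- If every vertex of a graph lies on an edge, then the cone over the graph is generated by the
triangles over the edges. -/
theorem exists_map_coneTriangle_eq {G : MultiDigraph} [Nonempty G.Edge]
    (hG : ∀ v, ∃ e, G.src e = v ∨ G.tgt e = v) {n : SimplexCategoryᵒᵖ}
    (x : (cone (graphSpace G)).obj n) :
    ∃ (e : G.Edge) (θ : op (.mk 2) ⟶ n),
      x = (cone (graphSpace G)).map θ (coneTriangle (genEdge e)) := by
  induction n using Opposite.rec with | _ n
  induction n using SimplexCategory.rec with | _ n
  change ConeSimplex (graphSpace G) n at x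
  cases x with
  | apex =>
    obtain ⟨e⟩ := ‹Nonempty G.Edge›
    exact ⟨e, (SimplexCategory.const _ _ 0).op, (ConeSimplex.map_part_of_forall_lt (m := .mk n)
      (n := .mk 2) (SimplexCategory.const _ _ 0) 1 1 rfl (genEdge e)
      (fun _ ↦ Nat.zero_lt_one)).symm⟩
  | part b l h σ =>
    obtain ⟨e, χ, rfl⟩ := exists_pullEdge_eq hG (n := l) σ
    have hθ (i : Fin (n + 1)) : (i : ℕ) < b ↔ ((consZero h χ).toOrderHom i : ℕ) < 1 := by
      simp only [consZero]
      by_cases hi : (i : ℕ) < b <;> simp [hi]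
    refine ⟨e, (consZero h χ).op, ((ConeSimplex.map_part_of_le (m := .mk n) (n := .mk 2)
      (consZero h χ) 1 1 rfl (genEdge e) b l h hθ).trans ?_).symm⟩
    congr 1
    change GraphSimplex.pullEdge e _ = _
    congr 1
    ext i
    simp [tail, consZero]

/-- A simplicial distribution on the cone over a graph is non-contextual as soon as there is a joint
distribution of outcomes at the vertices with the right moments. -/
theorem nonContextual_of_hasMoments {G : MultiDigraph} [Nonempty G.Edge]
    (hG : ∀ v, ∃ e, G.src e = v ∨ G.tgt e = v) (p : SDist (cone (graphSpace G)) NZ2)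
    (D : Dist (G.Vertex → ZMod 2))
    (hD : ∀ e, HasMoments D (fun s ↦ s (G.src e)) (fun s ↦ s (G.tgt e))
      (expectation p (coneEdge (genVertex (G.src e))))
      (expectation p (coneEdge (genVertex (G.tgt e))))
      (expectation p ((coneIncl _).app _ (genEdge e)))) : NonContextual p := by
  refine ⟨D.map coneAssignment, ?_⟩
  -- On the triangle over an edge both distributions are determined by the same three moments.
  have key (e : G.Edge) : (theta (D.map coneAssignment)).app _ (coneTriangle (genEdge e)) =
      p.app _ (coneTriangle (genEdge e)) := by
    refine map_injective (U := NZ2.obj (op (.mk 2))) triangleValue_injective ?_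
    refine Eq.trans ?_ ((hD e).map_eq (hasMoments_coneTriangle_genEdge p e))
    refine (StdSimplex.map_map _ _ _).trans ((StdSimplex.map_map _ _ _).trans ?_)
    congr 1
    funext s
    rw [triangleValue_coneTriangle, genEdge_δ_one, genEdge_δ_zero, edgeValue_coneAssignment,
      edgeValue_coneAssignment]
  ext n x
  obtain ⟨e, θ, rfl⟩ := exists_map_coneTriangle_eq hG x
  exact (NatTrans.naturality_apply _ _ _).trans
    ((congrArg _ (key e)).trans (NatTrans.naturality_apply _ _ _).symm)

/-! ### Circles -/

/-- The constant labelling `1` has the wrong parity, so some label is `0` and its term is `2`. -/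
theorem two_le_sum_one_add_sgn {M : ℕ} {b : Fin M → ZMod 2} (hb : ∑ i, b i = (M : ZMod 2) + 1) :
    2 ≤ ∑ i, (1 + sgn (b i)) := by
  obtain ⟨i, hi⟩ : ∃ i, b i ≠ 1 := by
    by_contra! hc
    simp [hc] at hb
  have h0 : b i = 0 := (zmod_two_cases _).resolve_right hi
  refine le_trans (le_of_eq ?_) (Finset.single_le_sum (fun j _ ↦ ?_) (Finset.mem_univ i))
  · rw [h0, sgn_zero]
    norm_num
  · rcases zmod_two_cases (b j) with h | h <;> rw [h] <;> norm_num

theorem circleInequalities_iff {M : ℕ} [NeZero M] {o : Fin M → Bool}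
    (q : SDist (circle M o) NZ2) : CircleInequalities q ↔
      ∀ a : Fin M → ZMod 2, ∑ i, a i = (M : ZMod 2) + 1 → 2 ≤ ∑ i : Fin M, (1 + sgn (a i) *
        expectation q (genEdge (G := circleGraph M o) i)) := by
  refine forall₂_congr fun a _ ↦ ?_
  rw [Finset.sum_add_distrib, Finset.sum_const, Finset.card_univ, Fintype.card_fin, nsmul_one,
    ← sub_nonneg (b := (2 : ℝ)), add_sub_right_comm]
  rfl

/-- The restriction of a non-contextual distribution on a cone to a circle satisfies the circle
inequalities. -/
theorem circleInequalities_theta {X : SSet.{0}} (d : Dist (cone X ⟶ NZ2)) {M : ℕ} [NeZero M]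
    {o : Fin M → Bool} (f : circle M o ⟶ X) :
    CircleInequalities (f ≫ coneIncl X ≫ theta d) := by
  rw [circleInequalities_iff]
  intro a ha
  have h1 (i : Fin M) : expectation (f ≫ coneIncl X ≫ theta d)
      (genEdge (G := circleGraph M o) i) = mean d (fun s ↦ sgn (edgeValue (s.app _
        ((coneIncl X).app _ (f.app _ (genEdge (G := circleGraph M o) i)))))) :=
    expectation_theta d _
  -- By linearity of `mean` the inequality may be checked on each assignment `s`.
  have h2 (s : cone X ⟶ NZ2) : 0 ≤ ∑ i, (1 + sgn (a i) * sgn (edgeValue (s.app _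
      ((coneIncl X).app _ (f.app _ (genEdge (G := circleGraph M o) i)))))) + -2 := by
    simp only [← sgn_add]
    refine sub_nonneg.2 (two_le_sum_one_add_sgn ?_)
    set h : Fin M → ZMod 2 := fun v ↦
      edgeValue (s.app _ (coneEdge (f.app _ (genVertex (G := circleGraph M o) v)))) with hh
    have hi (i : Fin M) : edgeValue (s.app _
        ((coneIncl X).app _ (f.app _ (genEdge (G := circleGraph M o) i)))) = h i + h (i + 1) := by
      rw [edgeValue_coneIncl, ← NatTrans.naturality_apply, ← NatTrans.naturality_apply,
        genEdge_δ_one (G := circleGraph M o) i, genEdge_δ_zero (G := circleGraph M o) i]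
      simp only [circleGraph, hh]
      cases o i
      · rfl
      · exact add_comm _ _
    simp only [hi]
    -- Every vertex of the circle is counted by its two neighbouring edges, so the edge values sum
    -- to zero.
    have hrot : ∑ i, h (i + 1) = ∑ i, h i := Equiv.sum_comp (Equiv.addRight (1 : Fin M)) h
    rw [Finset.sum_add_distrib, ha, Finset.sum_add_distrib, hrot, CharTwo.add_self_eq_zero,
      add_zero]
  have h3 := mean_nonneg d h2
  rw [mean_add, mean_sum, mean_const] at h3
  simp only [mean_add, mean_const, mean_const_mul, ← h1] at h3
  linarith

/-! ### Simplicial maps induced by graph homomorphisms -/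

/-- The map on simplices induced by a homomorphism of graphs. -/
def GraphSimplex.push {G H : MultiDigraph} (V : G.Vertex → H.Vertex) (E : G.Edge → H.Edge)
    {n : ℕ} : GraphSimplex G n → GraphSimplex H n
  | .vertex v => .vertex (V v)
  | .edge e χ hχ => .edge (E e) χ hχ

theorem GraphSimplex.push_pullEdge {G H : MultiDigraph} {V : G.Vertex → H.Vertex}
    {E : G.Edge → H.Edge} (hs : ∀ e, H.src (E e) = V (G.src e))
    (ht : ∀ e, H.tgt (E e) = V (G.tgt e)) {n : ℕ} (e : G.Edge) (χ : Fin (n + 1) →o Fin 2) :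
    GraphSimplex.push V E (.pullEdge e χ) = .pullEdge (E e) χ := by
  by_cases h : Function.Surjective χ
  · rw [pullEdge_of_surjective e h, pullEdge_of_surjective (E e) h]
    rfl
  · rw [GraphSimplex.pullEdge, dif_neg h, GraphSimplex.pullEdge, dif_neg h, hs, ht, ← apply_ite V]
    rfl

theorem GraphSimplex.push_injective {G H : MultiDigraph} {V : G.Vertex → H.Vertex}
    {E : G.Edge → H.Edge} (hV : Function.Injective V) (hE : Function.Injective E) {n : ℕ} :
    Function.Injective (GraphSimplex.push V E : GraphSimplex G n → GraphSimplex H n) := by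
  rintro (v | ⟨e, χ, hχ⟩) (v' | ⟨e', χ', hχ'⟩) h
  · exact congrArg _ (hV (GraphSimplex.vertex.inj h))
  · cases h
  · cases h
  · obtain ⟨h1, rfl⟩ := GraphSimplex.edge.inj h
    obtain rfl := hE h1
    rfl

/-- The simplicial map induced by a homomorphism of graphs. -/
def graphMap {G H : MultiDigraph} (V : G.Vertex → H.Vertex) (E : G.Edge → H.Edge)
    (hs : ∀ e, H.src (E e) = V (G.src e)) (ht : ∀ e, H.tgt (E e) = V (G.tgt e)) :
    graphSpace G ⟶ graphSpace H where
  app n := ↾(GraphSimplex.push V E : GraphSimplex G n.unop.len → GraphSimplex H n.unop.len)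
  naturality m n θ := by
    ext σ
    cases σ with
    | vertex v => rfl
    | edge e χ hχ => exact GraphSimplex.push_pullEdge hs ht e (χ.comp θ.unop.toOrderHom)

theorem mono_graphMap {G H : MultiDigraph} {V : G.Vertex → H.Vertex} {E : G.Edge → H.Edge}
    {hs : ∀ e, H.src (E e) = V (G.src e)} {ht : ∀ e, H.tgt (E e) = V (G.tgt e)}
    (hV : Function.Injective V) (hE : Function.Injective E) : Mono (graphMap V E hs ht) := by
  rw [NatTrans.mono_iff_mono_app]
  intro n
  rw [mono_iff_injective]
  exact GraphSimplex.push_injective hV hE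

/-! ### Circles formed by two petals of a flower -/

/-- The points of the closed walk along the petal `i` and back along the petal `i'`. -/
def loopPoint {k : ℕ} (N : Fin k → ℕ) (i i' : Fin k) (r : ℕ) : FlowerVertex N :=
  if r < N i then petalPoint N i r else petalPoint N i' (N i + N i' - r)

/-- The edges of the closed walk along the petal `i` and back along the petal `i'`. -/
def loopEdge {k : ℕ} (N : Fin k → ℕ) (i i' : Fin k) (r : Fin (N i + N i')) : Σ i, Fin (N i) :=
  if h : (r : ℕ) < N i then ⟨i, r, h⟩ else ⟨i', N i + N i' - 1 - r, by omega⟩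

/-- The directions of the edges of the closed walk along the petal `i` and back along the petal
`i'`. -/
def loopDirection {k : ℕ} (N : Fin k → ℕ) (o : ∀ i, Fin (N i) → Bool) (i i' : Fin k)
    (r : Fin (N i + N i')) : Bool :=
  if h : (r : ℕ) < N i then o i ⟨r, h⟩ else !(o i' ⟨N i + N i' - 1 - r, by omega⟩)

/-- Apart from interior steps there are two junctions: the walk changes petals at `w` when `r + 1 =
N i`, and wraps around to `v` at the end. -/
theorem loopPoint_add_one {k : ℕ} {N : Fin k → ℕ} {i i' : Fin k} (hi : 1 ≤ N i) (hi' : 1 ≤ N i')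
    [NeZero (N i + N i')] (r : Fin (N i + N i')) :
    loopPoint N i i' (r + 1 : Fin (N i + N i')) = if (r : ℕ) < N i then petalPoint N i (r + 1)
      else petalPoint N i' (N i + N i' - 1 - r) := by
  have hr := r.2
  rw [Fin.val_add, Fin.val_one', Nat.add_mod_mod]
  rcases Nat.lt_or_ge (r + 1) (N i + N i') with h | h
  · rw [Nat.mod_eq_of_lt h, loopPoint]
    split_ifs with h1 h2 h2
    · rfl
    · omega
    · obtain h3 : (r : ℕ) + 1 = N i := by omega
      rw [h3, Nat.add_sub_cancel_left, petalPoint_last (by omega), petalPoint_last (by omega)]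
    · congr 1
      omega
  · obtain h3 : (r : ℕ) + 1 = N i + N i' := by omega
    rw [h3, Nat.mod_self, loopPoint, if_pos (by omega), if_neg (by omega),
      show N i + N i' - 1 - (r : ℕ) = 0 by omega]
    rfl

theorem flowerGraph_src {k : ℕ} {N : Fin k → ℕ} {o : ∀ i, Fin (N i) → Bool} (i : Fin k)
    (j : Fin (N i)) : (flowerGraph N o).src ⟨i, j⟩ =
      if o i j then petalPoint N i (j + 1) else petalPoint N i j := by
  simp only [flowerGraph, linePoint_eq_petalPoint]
  rfl

theorem flowerGraph_tgt {k : ℕ} {N : Fin k → ℕ} {o : ∀ i, Fin (N i) → Bool} (i : Fin k)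
    (j : Fin (N i)) : (flowerGraph N o).tgt ⟨i, j⟩ =
      if o i j then petalPoint N i j else petalPoint N i (j + 1) := by
  simp only [flowerGraph, linePoint_eq_petalPoint]
  rfl

theorem loop_src_tgt {k : ℕ} {N : Fin k → ℕ} {i i' : Fin k} (hi : 1 ≤ N i) (hi' : 1 ≤ N i')
    [NeZero (N i + N i')] (o : ∀ i, Fin (N i) → Bool) (r : Fin (N i + N i')) :
    (flowerGraph N o).src (loopEdge N i i' r) =
      loopPoint N i i' (if loopDirection N o i i' r then r + 1 else r : Fin (N i + N i')) ∧
    (flowerGraph N o).tgt (loopEdge N i i' r) =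
      loopPoint N i i' (if loopDirection N o i i' r then r else r + 1 : Fin (N i + N i')) := by
  have hr := r.2
  have h1 := loopPoint_add_one hi hi' r
  unfold loopEdge loopDirection
  by_cases h : (r : ℕ) < N i
  · have h0 : loopPoint N i i' r = petalPoint N i r := if_pos h
    rw [if_pos h] at h1
    rw [dif_pos h, dif_pos h, flowerGraph_src, flowerGraph_tgt]
    cases o i ⟨r, h⟩
    exacts [⟨h0.symm, h1.symm⟩, ⟨h1.symm, h0.symm⟩]
  · have h0 : loopPoint N i i' r = petalPoint N i' (N i + N i' - 1 - r + 1) :=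
      (if_neg h).trans (by congr 1; omega)
    rw [if_neg h] at h1
    rw [dif_neg h, dif_neg h, flowerGraph_src, flowerGraph_tgt]
    cases o i' ⟨N i + N i' - 1 - r, by omega⟩
    exacts [⟨h1.symm, h0.symm⟩, ⟨h0.symm, h1.symm⟩]

theorem loopPoint_injective {k : ℕ} {N : Fin k → ℕ} {i i' : Fin k} (hne : i ≠ i') :
    Function.Injective (fun r : Fin (N i + N i') ↦ loopPoint N i i' r) := by
  intro r s h
  have hr := r.2
  have hs := s.2
  have hne' := hne.symm
  ext
  simp only [loopPoint, petalPoint] at h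
  split_ifs at h <;> simp_all <;> omega

theorem loopEdge_injective {k : ℕ} {N : Fin k → ℕ} {i i' : Fin k} (hne : i ≠ i') :
    Function.Injective (loopEdge N i i') := by
  intro r s h
  have hr := r.2
  have hs := s.2
  have hne' := hne.symm
  ext
  simp only [loopEdge] at h
  split_ifs at h <;> simp_all
  omega

theorem sum_fin_add_reverse {M : Type} [AddCommMonoid M] (n n' : ℕ) (F G : ℕ → M) :
    ∑ r : Fin (n + n'), (if (r : ℕ) < n then F r else G (n + n' - 1 - r)) =
      ∑ j ∈ Finset.range n, F j + ∑ j ∈ Finset.range n', G j := by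
  rw [Fin.sum_univ_eq_sum_range (fun r ↦ if r < n then F r else G (n + n' - 1 - r)),
    Finset.sum_range_add, ← Finset.sum_range_reflect G]
  congr 1
  · exact Finset.sum_congr rfl fun r hr ↦ if_pos (Finset.mem_range.1 hr)
  · refine Finset.sum_congr rfl fun r hr ↦ ?_
    rw [if_neg (by omega)]
    congr 1
    omega

/-- The expectation value of the `j`-th edge of the petal `i`. -/
def petalExpectation {k : ℕ} {N : Fin k → ℕ} {o : ∀ i, Fin (N i) → Bool}
    (q : SDist (flowerBase N o) NZ2) (i : Fin k) (j : ℕ) : ℝ :=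
  if h : j < N i then expectation q (genEdge (G := flowerGraph N o) ⟨i, j, h⟩) else 0

/-- Distinct petals meet only in `v` and `w`, so the closed walk is an embedded circle with `N i + N
i'` edges. The parities of `a` and `a'` add up to the one required by its circle inequality. -/
theorem two_le_pathSum_of_circleInequalities {k : ℕ} {N : Fin k → ℕ} {o : ∀ i, Fin (N i) → Bool}
    (q : SDist (flowerBase N o) NZ2)
    (hq : ∀ (M : ℕ) [NeZero M] (o' : Fin M → Bool) (f : circle M o' ⟶ flowerBase N o),
      Mono f → CircleInequalities (f ≫ q))
    {i i' : Fin k} (hne : i ≠ i') (hi : 1 ≤ N i) (hi' : 1 ≤ N i') {a a' : ℕ → ZMod 2}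
    (ha : ∑ j ∈ Finset.range (N i), a j = N i)
    (ha' : ∑ j ∈ Finset.range (N i'), a' j = N i' + 1) :
    2 ≤ pathSum (petalExpectation q i) (N i) a + pathSum (petalExpectation q i') (N i') a' := by
  have : NeZero (N i + N i') := ⟨by omega⟩
  have hmono : Mono (graphMap (G := circleGraph (N i + N i') (loopDirection N o i i'))
      (H := flowerGraph N o) (fun r : Fin (N i + N i') ↦ loopPoint N i i' r) (loopEdge N i i')
      (fun r ↦ (loop_src_tgt hi hi' o r).1) (fun r ↦ (loop_src_tgt hi hi' o r).2)) :=
    mono_graphMap (loopPoint_injective hne) (loopEdge_injective hne)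
  have h := (circleInequalities_iff _).1 (hq _ _ _ hmono)
    (fun r ↦ if (r : ℕ) < N i then a r else a' (N i + N i' - 1 - r)) (by
      rw [sum_fin_add_reverse, ha, ha', Nat.cast_add, add_assoc])
  refine h.trans (le_of_eq (Eq.trans ?_ (sum_fin_add_reverse (N i) (N i') _ _)))
  refine Finset.sum_congr rfl fun r _ ↦ ?_
  have hr : expectation q (genEdge (G := flowerGraph N o) (loopEdge N i i' r)) =
      if (r : ℕ) < N i then petalExpectation q i r
      else petalExpectation q i' (N i + N i' - 1 - r) := by
    have := r.2
    unfold loopEdge petalExpectation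
    split_ifs <;> first | rfl | omega
  refine (congrArg (fun z ↦ 1 + sgn _ * z) hr).trans ?_
  split_ifs <;> rfl

/-! ### Edges at each vertex and independence of edge directions -/

theorem flowerGraph_exists_edge {k : ℕ} (hk : 1 ≤ k) {N : Fin k → ℕ} (hN : ∀ i, 1 ≤ N i)
    (o : ∀ i, Fin (N i) → Bool) (x : (flowerGraph N o).Vertex) :
    ∃ e, (flowerGraph N o).src e = x ∨ (flowerGraph N o).tgt e = x := by
  have key (i : Fin k) (j : Fin (N i)) (h : petalPoint N i j = x ∨ petalPoint N i (j + 1) = x) :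
      ∃ e, (flowerGraph N o).src e = x ∨ (flowerGraph N o).tgt e = x := by
    refine ⟨⟨i, j⟩, ?_⟩
    rw [flowerGraph_src, flowerGraph_tgt]
    cases o i j
    · exact h
    · exact h.symm
  cases x with
  | v => exact key ⟨0, hk⟩ ⟨0, hN _⟩ (Or.inl rfl)
  | w =>
    have h := hN ⟨0, hk⟩
    refine key ⟨0, hk⟩ ⟨N ⟨0, hk⟩ - 1, by omega⟩ (Or.inr ?_)
    simp only [Nat.sub_add_cancel h]
    exact petalPoint_last (by omega)
  | inner i j hj =>
    refine key i ⟨j, hj.2⟩ (Or.inl ?_)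
    simp [petalPoint, hj.2, hj.1.ne']

/-- Reversing an edge only swaps the two variables, which leaves their correlation unchanged; so
every petal may be treated as directed from `v` to `w`. -/
theorem hasMoments_orient {U W : Type} {p : Dist U} {F : U → W → ZMod 2} {m : W → ℝ} {x y : W}
    {c : ℝ} (b : Bool) : HasMoments p (fun u ↦ F u (if b then y else x))
      (fun u ↦ F u (if b then x else y)) (m (if b then y else x)) (m (if b then x else y)) c ↔
    HasMoments p (fun u ↦ F u x) (fun u ↦ F u y) (m x) (m y) c := by
  cases b
  · exact Iff.rfl
  · exact ⟨HasMoments.symm, HasMoments.symm⟩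

theorem frechet_orient {W : Type} {m : W → ℝ} {x y : W} {c : ℝ} (b : Bool) :
    Frechet (m (if b then y else x)) (m (if b then x else y)) c ↔ Frechet (m x) (m y) c := by
  cases b
  · exact Iff.rfl
  · exact ⟨Frechet.symm, Frechet.symm⟩

end SimplicialContextuality

end

theorem mainTheorem1 (k : ℕ) (hk : 1 ≤ k) (N : Fin k → ℕ) (hN : ∀ i, 1 ≤ N i)
    (o : ∀ i, Fin (N i) → Bool)
    (p : SimplicialContextuality.SDist
      (SimplicialContextuality.cone (SimplicialContextuality.flowerBase N o))
      SimplicialContextuality.NZ2) :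
    SimplicialContextuality.NonContextual p ↔
      ∀ (M : ℕ) [NeZero M] (o' : Fin M → Bool)
        (f : SimplicialContextuality.circle M o' ⟶ SimplicialContextuality.flowerBase N o),
        Mono f →
        SimplicialContextuality.CircleInequalities
          (f ≫ SimplicialContextuality.coneIncl (SimplicialContextuality.flowerBase N o) ≫ p) := by
  open SimplicialContextuality in
  constructor
  · rintro ⟨d, rfl⟩ M _ o' f -
    exact circleInequalities_theta d f
  · intro h
    have : Nonempty (flowerGraph N o).Edge := ⟨⟨⟨0, hk⟩, ⟨0, hN _⟩⟩⟩
    set q : SDist (flowerBase N o) NZ2 := coneIncl (flowerBase N o) ≫ p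
    set m : FlowerVertex N → ℝ := fun x ↦
      expectation p (coneEdge (genVertex (G := flowerGraph N o) x))
    have hx (i : Fin k) (j : ℕ) (hj : j < N i) : petalExpectation q i j =
        expectation p ((coneIncl _).app _ (genEdge (G := flowerGraph N o) ⟨i, ⟨j, hj⟩⟩)) :=
      dif_pos hj
    -- The Fréchet bounds hold because each triangle over an edge carries an actual distribution;
    -- the pairwise petal bounds come from the circles.
    obtain ⟨D, hD⟩ := exists_flower_dist hk hN (m := m) (x := petalExpectation q)
      (fun i j hj ↦ by
        have h1 := (hasMoments_coneTriangle_genEdge (G := flowerGraph N o) p ⟨i, ⟨j, hj⟩⟩).frechet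
        rw [← hx, flowerGraph_src, flowerGraph_tgt] at h1
        exact (frechet_orient (m := m) (o i ⟨j, hj⟩)).1 h1)
      (fun i i' hne a a' ha ha' ↦
        two_le_pathSum_of_circleInequalities q h hne (hN i) (hN i') ha ha')
    refine nonContextual_of_hasMoments (flowerGraph_exists_edge hk hN o) p D ?_
    rintro ⟨i, ⟨j, hj⟩⟩
    rw [← hx, flowerGraph_src, flowerGraph_tgt]
    exact (hasMoments_orient (F := fun (s : FlowerVertex N → ZMod 2) x ↦ s x) (m := m) (o i ⟨j, hj⟩)).2 (hD i j hj)
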